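/- Let $d\ge 1$, $n\ge 0$, $\lambda=(\lambda_1,\dots,\lambda_n)\in[0,1]^n$. For a probability distribution $P$ on $\mathbb R^d$ with mean $\mu_P$, a random dataset $Z=(Z_1,\dots,Z_n)$ is $\lambda$-contaminated from $P$, written $Z\sim_\lambda P$, if $Z_i=(1-B_i)X_i+B_i\tilde X_i$, where $X_1,\dots,X_n$ are i.i.d. from $P$, $B_i\sim\mathrm{Bern}(\lambda_i)$ are independent of each other and of the $X_i$, and the outliers $(\tilde X_1,\dots,\tilde X_n)$ are drawn from an arbitrary joint distribution conditional on $(X_1,\dots,X_n,B_1,\dots,B_n)$ (the adversary). For a class $\mathcal D$ of distributions on $\mathbb R^d$ let $$L_{\mathsf{PAC}}(\lambda,\mathcal D)=\inf\Big\{t:\ \inf_M\ \sup_{P\in\mathcal D}\ \Pr_{Z\sim_\lambda P}\big[\|M(Z)-\mu_P\|_2^2\ge t\big]\le \tfrac15\Big\},$$ where $M$ ranges over all estimators and the supremum is over both $P\in\mathcal D$ and the adversary. Let $\mathcal D_d^{\mathcal N}=\{\mathcal N(\mu,I_d):\mu\in\mathbb R^d\}$, $N(t)=|\{i:\lambda_i\le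 t\}|$, and $$f(\lambda,d)=\min_{t\in[0,1]}\Big(t^2+\frac{d}{N(t)}\Big),$$ with $d/0=+\infty$. For weights $w\in\mathbb R_{\ge 0}^n$, the weighted Tukey depth of $\eta\in\mathbb R^d$ in $Z$ is $D_w(\eta,Z)=\min_{\|v\|_2=1}\sum_{i=1}^n w_i\,\mathbb 1\{v^{T}(Z_i-\eta)\ge 0\}$, and a weighted Tukey median is a maximizer of $\eta\mapsto D_w(\eta,Z)$. Let $w(t)_i=\mathbb 1\{\lambda_i\le t\}/N(t)$ (and $w(t)=0$ if $N(t)=0$). **Theorem.** There are universal constants $c,c_1,C>0$ such that for all $d\ge1$, $n$ and $\lambda\in[0,1]^n$ with $f(\lambda,d)\le c$, $$\frac{c_1}{\sqrt d}\, f(\lambda,d)\ \le\ L_{\mathsf{PAC}}(\lambda,\mathcal D_d^{\mathcal N})\ \le\ C\, f(\lambda,d).$$ Moreover, the minimum defining $f(\lambda,d)$ is attained, weighted Tukey medians with weights $w(t)$ exist for every $t\in[0,1]$ and every dataset, and for every minimizer $t^*\in\arg\min_{t\in[0,1]}(t^2+d/N(t))$ every weighted Tukey median $\hat\mu(Z)$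 with weights $w(t^*)$ attains the upper bound: $$\sup_{P\in\mathcal D_d^{\mathcal N}}\Pr_{Z\sim_\lambda P}\big[\|\hat\mu(Z)-\mu_P\|_2^2\ge C\, f(\lambda,d)\big]\le\tfrac15,$$ the supremum again being over both $P$ and the adversary. -/

import Mathlib

open MeasureTheory ProbabilityTheory
open scoped ENNReal NNReal unitInterval

noncomputable section

/-- The possible laws of a `lam`-contaminated dataset `Z = (Z₁, …, Zₙ)` with clean distribution `P`.
The clean samples `X` are i.i.d. from `P`, the flags `B i ~ Bern (lam i)` are independent of each
other and of `X`, and the adversary is an arbitrary Markov kernel `κ` drawing the outliers `X'`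
jointly, conditionally on `(X, B)`. The observed sample is `Z i = (1 - B i) X i + B i X' i`. -/
def contaminatedLaws {n : ℕ} {E : Type*} [MeasurableSpace E] (lam : Fin n → I) (P : Measure E) :
    Set (Measure (Fin n → E)) :=
  {ν | ∃ κ : Kernel ((Fin n → E) × (Fin n → Bool)) (Fin n → E), IsMarkovKernel κ ∧
    ν = (((Measure.pi fun _ ↦ P).prod
        (Measure.pi fun i ↦ bernoulliMeasure true false (lam i))) ⊗ₘ κ).map
      (fun q i ↦ if q.1.2 i = true then q.2 i else q.1.1 i)}

/-- The minimax PAC rate, with failure probability `δ`, for squared `ℓ²` error of mean estimation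
over the class `𝒟` under `lam`-contamination. Estimators are the measurable maps, and the supremum
is over the clean distribution and over the adversary. -/
def minimaxPAC {n d : ℕ} (lam : Fin n → I) (𝒟 : Set (Measure (EuclideanSpace ℝ (Fin d))))
    (δ : ℝ≥0∞) : ℝ≥0∞ :=
  sInf {t : ℝ≥0∞ |
    (⨅ (M : (Fin n → EuclideanSpace ℝ (Fin d)) → EuclideanSpace ℝ (Fin d)) (_ : Measurable M),
      ⨆ P ∈ 𝒟, ⨆ ν ∈ contaminatedLaws lam P, ν {z | t ≤ ‖M z - ∫ x, x ∂P‖ₑ ^ 2}) ≤ δ}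

/-- The Gaussian distributions on `ℝ^d` with identity covariance. -/
def idGaussians (d : ℕ) : Set (Measure (EuclideanSpace ℝ (Fin d))) :=
  {P | ∃ μ : EuclideanSpace ℝ (Fin d), P = multivariateGaussian μ 1}

/-- `N(t) = |{i : lam i ≤ t}|`. -/
def numBelow {n : ℕ} (lam : Fin n → I) (t : I) : ℕ :=
  (Finset.univ.filter fun i ↦ lam i ≤ t).card

/-- `t² + d / N(t)`, equal to `∞` when `N(t) = 0 < d`. -/
def thresholdObjective {n : ℕ} (d : ℕ) (lam : Fin n → I) (t : I) : ℝ≥0∞ :=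
  ENNReal.ofReal ((t : ℝ) ^ 2) + (d : ℝ≥0∞) / (numBelow lam t : ℝ≥0∞)

/-- `f(lam, d) = min_{t ∈ [0,1]} (t² + d / N(t))`. -/
def effectiveRate {n : ℕ} (d : ℕ) (lam : Fin n → I) : ℝ≥0∞ :=
  ⨅ t : I, thresholdObjective d lam t

open Classical in
/-- The weighted Tukey depth of `η` in the dataset `z`: the minimum over unit vectors `v` of the
weight of the samples in the closed half-space `⟪v, x - η⟫ ≥ 0`. -/
def tukeyDepth {n d : ℕ} (w : Fin n → ℝ) (z : Fin n → EuclideanSpace ℝ (Fin d))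
    (η : EuclideanSpace ℝ (Fin d)) : ℝ :=
  ⨅ v : Metric.sphere (0 : EuclideanSpace ℝ (Fin d)) 1,
    ∑ i, w i * (if 0 ≤ inner ℝ (v : EuclideanSpace ℝ (Fin d)) (z i - η) then 1 else 0)

/-- `η` is a weighted Tukey median of `z`: a maximizer of the weighted Tukey depth. -/
def IsTukeyMedian {n d : ℕ} (w : Fin n → ℝ) (z : Fin n → EuclideanSpace ℝ (Fin d))
    (η : EuclideanSpace ℝ (Fin d)) : Prop :=
  ∀ η', tukeyDepth w z η' ≤ tukeyDepth w z η

/-- The weights `w(t)`, uniform on the samples with `lam i ≤ t` and zero on the others. -/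
def thresholdWeights {n : ℕ} (lam : Fin n → I) (t : I) (i : Fin n) : ℝ :=
  if lam i ≤ t then 1 / (numBelow lam t : ℝ) else 0

end

/-!
Upper bound. On the `N = N(t)` samples of rate at most `t`, the expected number of outliers is at
most `N * t`. The class of half-spaces of `ℝ^d` has VC dimension at most `d + 1`, so by
symmetrization and chaining the number of clean samples in every half-space is within `O(√(d * N))`
of its mean, simultaneously. With probability at least `4 / 5`, then, the depth of any point in the
data is `N` times its Gaussian depth, up to `O(N * t + √(d * N))`. The true mean is thus almost
`N / 2`-deep, so the Tukey median is too, and a point at distance `s` from the mean has Gaussian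
depth at most `1 / 2` minus a multiple of `s`: hence `s² = O(t² + d / N)`.

Lower bound. Put the mean at a vertex of the cube with vertices `± a` on about `√d` coordinates. The
likelihood ratio of every vertex is dominated by a product of one-dimensional envelopes, whose
integral is at most `exp (3 * a * √d)`; normalizing it gives one law `Q` which an adversary with
contamination rate at least `3 * a * √d` can produce whatever the vertex. The samples with such a
rate therefore reveal nothing, the others cannot decide the sign of a single coordinate because
`N * a²` is small, and Assouad's lemma yields the error `a² * √d`. With `a² ≍ f / d` this is
`f / √d`.
-/

section Rademacher

open Finset
open scoped BigOperators

lemma exp_expect_le {κ : Type*} [Fintype κ] [Nonempty κ] (f : κ → ℝ) :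
    Real.exp (𝔼 k, f k) ≤ 𝔼 k, Real.exp (f k) := by
  set c := 𝔼 k, f k
  calc Real.exp c = 𝔼 k, Real.exp c * (f k - c + 1) := by
        simp [← mul_expect, expect_add_distrib, expect_sub_distrib, c]
    _ ≤ 𝔼 k, Real.exp (f k) := expect_le_expect fun k _ ↦ by
        have tangent :=
          mul_le_mul_of_nonneg_left (Real.add_one_le_exp (f k - c)) (Real.exp_pos c).le
        rwa [← Real.exp_add, add_sub_cancel] at tangent

variable {ι τ W : Type*} [Fintype ι] [DecidableEq ι] [NormedAddCommGroup W]

/-- The Rademacher average `𝔼 ‖∑ᵢ ± xᵢ‖` of the vectors `xᵢ`. The supremum of a finite class of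
functions over a sample is the case of the sup norm, `W = τ → ℝ`. -/
noncomputable def rademacherAverage (x : ι → W) : ℝ :=
  𝔼 ε : ι → ℤˣ, ‖∑ i, ε i • x i‖

lemma rademacherAverage_nonneg (x : ι → W) : 0 ≤ rademacherAverage x :=
  expect_nonneg fun _ _ ↦ norm_nonneg _

lemma rademacherAverage_neg (x : ι → W) : rademacherAverage (-x) = rademacherAverage x := by
  simp only [rademacherAverage, Pi.neg_apply, smul_neg, sum_neg_distrib, norm_neg]

lemma rademacherAverage_add_le (x y : ι → W) :
    rademacherAverage (x + y) ≤ rademacherAverage x + rademacherAverage y := by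
  rw [rademacherAverage, rademacherAverage, rademacherAverage, ← expect_add_distrib]
  refine expect_le_expect fun ε _ ↦ ?_
  simpa only [Pi.add_apply, smul_add, sum_add_distrib] using norm_add_le _ _

lemma rademacherAverage_comp_le {κ : Type*} [Fintype κ] [Fintype τ] (p : κ → τ) (x : ι → τ → ℝ) :
    rademacherAverage (fun i ↦ x i ∘ p) ≤ rademacherAverage x := by
  refine expect_le_expect fun ε _ ↦ (pi_norm_le_iff_of_nonneg (norm_nonneg _)).2 fun k ↦ ?_
  simpa only [Finset.sum_apply, Pi.smul_apply, Function.comp_apply] using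
    norm_le_pi_norm (∑ i, ε i • x i) (p k)

lemma expect_exp_sum_units_smul_le (a : ι → ℝ) :
    𝔼 ε : ι → ℤˣ, Real.exp (∑ i, ε i • a i) ≤ Real.exp ((∑ i, a i ^ 2) / 2) := by
  have sum_eq_prod : ∑ ε : ι → ℤˣ, Real.exp (∑ i, ε i • a i) = ∏ i, (2 * Real.cosh (a i)) := by
    simp_rw [Real.exp_sum, ← Fintype.piFinset_univ]
    rw [sum_prod_piFinset univ fun i (u : ℤˣ) ↦ Real.exp (u • a i)]
    refine prod_congr rfl fun i _ ↦ ?_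
    rw [Real.cosh_eq, show (univ : Finset ℤˣ) = {1, -1} from rfl, sum_pair (by decide)]
    simp only [one_smul, Units.neg_smul]
    ring
  calc 𝔼 ε : ι → ℤˣ, Real.exp (∑ i, ε i • a i) = ∏ i, Real.cosh (a i) := by
        rw [Fintype.expect_eq_sum_div_card, sum_eq_prod, prod_mul_distrib]
        simp
    _ ≤ ∏ i, Real.exp (a i ^ 2 / 2) :=
        prod_le_prod (fun i _ ↦ (Real.cosh_pos _).le) fun i _ ↦ Real.cosh_le_exp_half_sq _
    _ = Real.exp ((∑ i, a i ^ 2) / 2) := by rw [← Real.exp_sum, sum_div]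

lemma exp_norm_le_sum_exp_add_exp_neg [Fintype τ] [Nonempty τ] (y : τ → ℝ) :
    Real.exp ‖y‖ ≤ ∑ t, (Real.exp (y t) + Real.exp (-y t)) := by
  obtain ⟨t, ht⟩ : ∃ t, ‖y‖ = ‖y t‖ := by
    obtain ⟨t, -, ht⟩ := exists_mem_eq_sup univ univ_nonempty fun t ↦ ‖y t‖₊
    exact ⟨t, by rw [Pi.norm_def, ht, coe_nnnorm]⟩
  calc Real.exp ‖y‖ ≤ Real.exp (y t) + Real.exp (-y t) := by
        rw [ht, Real.norm_eq_abs]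
        exact Real.exp_abs_le (y t)
    _ ≤ ∑ t, (Real.exp (y t) + Real.exp (-y t)) :=
        single_le_sum (f := fun t ↦ Real.exp (y t) + Real.exp (-y t))
          (fun t _ ↦ by positivity) (mem_univ t)

lemma mul_rademacherAverage_le [Fintype τ] [Nonempty τ] (x : ι → τ → ℝ) {S l : ℝ} (hl : 0 ≤ l)
    (hx : ∀ t, ∑ i, x i t ^ 2 ≤ S) :
    l * rademacherAverage x ≤ Real.log (2 * Fintype.card τ) + l ^ 2 * S / 2 := by
  have exp_moment : ∀ k : ℝ, k ^ 2 = l ^ 2 → ∀ t,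
      𝔼 ε : ι → ℤˣ, Real.exp (∑ i, ε i • (k * x i t)) ≤ Real.exp (l ^ 2 * S / 2) := fun k hk t ↦ by
    refine (expect_exp_sum_units_smul_le _).trans (Real.exp_le_exp.2 ?_)
    simp only [mul_pow, ← mul_sum, hk]
    gcongr
    exact hx t
  have hτ : (0 : ℝ) < 2 * Fintype.card τ := by positivity
  rw [← Real.exp_le_exp, Real.exp_add, Real.exp_log hτ]
  calc Real.exp (l * rademacherAverage x)
      = Real.exp (𝔼 ε : ι → ℤˣ, ‖l • ∑ i, ε i • x i‖) := by
        simp only [norm_smul, Real.norm_of_nonneg hl, ← mul_expect, rademacherAverage]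
    _ ≤ 𝔼 ε : ι → ℤˣ, ∑ t, (Real.exp (∑ i, ε i • (l * x i t))
          + Real.exp (∑ i, ε i • (-l * x i t))) := by
        refine (exp_expect_le _).trans (expect_le_expect fun ε _ ↦ ?_)
        have coord (t : τ) : (l • ∑ i, ε i • x i) t = ∑ i, ε i • (l * x i t) := by
          simp only [Pi.smul_apply, Finset.sum_apply, smul_eq_mul, mul_sum, mul_smul_comm]
        simpa only [coord, neg_mul, smul_neg, sum_neg_distrib] using
          exp_norm_le_sum_exp_add_exp_neg (l • ∑ i, ε i • x i)
    _ ≤ ∑ _t : τ, (Real.exp (l ^ 2 * S / 2) + Real.exp (l ^ 2 * S / 2)) := by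
        rw [expect_sum_comm]
        refine sum_le_sum fun t _ ↦ ?_
        rw [expect_add_distrib]
        exact add_le_add (exp_moment l rfl t) (exp_moment (-l) (neg_sq l) t)
    _ = 2 * Fintype.card τ * Real.exp (l ^ 2 * S / 2) := by
        rw [sum_const, card_univ, nsmul_eq_mul]
        ring

/-- Massart's finite class lemma. -/
lemma rademacherAverage_le_sqrt [Fintype τ] (x : ι → τ → ℝ) {S L : ℝ} (hS : 0 < S)
    (hL : 0 < L) (hx : ∀ t, ∑ i, x i t ^ 2 ≤ S) (hcard : Real.log (2 * Fintype.card τ) ≤ L) :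
    rademacherAverage x ≤ √(2 * S * L) := by
  cases isEmpty_or_nonempty τ
  · simp [rademacherAverage, norm_of_subsingleton]
  -- `l = √(2 L / S)` balances the two terms of the exponential moment bound
  have hl : 0 < √(2 * L / S) := by positivity
  refine le_of_mul_le_mul_left ?_ hl
  calc √(2 * L / S) * rademacherAverage x ≤ L + √(2 * L / S) ^ 2 * S / 2 :=
        (mul_rademacherAverage_le x hl.le hx).trans (by gcongr)
    _ = 2 * L := by rw [Real.sq_sqrt (by positivity)]; field_simp; ring
    _ = √(2 * L / S) * √(2 * S * L) := by
        rw [← Real.sqrt_mul (by positivity), show 2 * L / S * (2 * S * L) = (2 * L) ^ 2 by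
          field_simp, Real.sqrt_sq (by positivity)]

end Rademacher

section VCDimension

open Finset
open scoped symmDiff

variable {ι κ : Type*} [Fintype κ]

open Classical in
/-- The trace of a set `A` on the points `p j`, as a set of indices `j` (the points may repeat). -/
noncomputable def indexTrace (p : κ → ι) (A : Set ι) : Finset κ := {j | p j ∈ A}

@[simp] lemma mem_indexTrace {p : κ → ι} {A : Set ι} {j : κ} : j ∈ indexTrace p A ↔ p j ∈ A := by
  simp [indexTrace]

variable [DecidableEq ι]

lemma vcDim_image_indexTrace_le [DecidableEq κ] (p : κ → ι) (F : Finset (Finset ι)) :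
    (F.image fun f : Finset ι ↦ indexTrace p f).vcDim ≤ F.vcDim := by
  refine Finset.sup_le fun S hS ↦ ?_
  rw [mem_shatterer] at hS
  have exists_trace_eq : ∀ t ⊆ S, ∃ f ∈ F, ∀ j ∈ S, (p j ∈ f ↔ j ∈ t) := by
    intro t ht
    obtain ⟨u, hu, rfl⟩ := hS ht
    obtain ⟨f, hf, rfl⟩ := mem_image.1 hu
    exact ⟨f, hf, fun j hj ↦ by simp [hj]⟩
  have injOn : Set.InjOn p S := by
    intro i hi j hj hij
    obtain ⟨f, -, hf⟩ := exists_trace_eq {i} (singleton_subset_iff.2 hi)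
    have hmem := (hf i hi).2 (mem_singleton_self i)
    rw [hij, hf j hj, mem_singleton] at hmem
    exact hmem.symm
  rw [← card_image_of_injOn injOn]
  refine Shatters.card_le_vcDim fun t ht ↦ ?_
  obtain ⟨f, hf, hft⟩ := exists_trace_eq {j ∈ S | p j ∈ t} (filter_subset _ _)
  refine ⟨f, hf, ext fun i ↦ ⟨fun hi ↦ ?_, fun hi ↦ ?_⟩⟩
  · obtain ⟨hiS, hif⟩ := mem_inter.1 hi
    obtain ⟨j, hj, rfl⟩ := mem_image.1 hiS
    exact (mem_filter.1 ((hft j hj).1 hif)).2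
  · obtain ⟨j, hj, rfl⟩ := mem_image.1 (ht hi)
    exact mem_inter.2 ⟨ht hi, (hft j hj).2 (mem_filter.2 ⟨hj, hi⟩)⟩

lemma exists_separated_net (F : Finset (Finset ι)) {r : ℝ} (hr : 0 ≤ r) :
    ∃ A ⊆ F, (A : Set (Finset ι)).Pairwise (fun f g ↦ r < #(f ∆ g)) ∧
      ∀ f ∈ F, ∃ g ∈ A, (#(f ∆ g) : ℝ) ≤ r := by
  classical
  set separated : Finset (Finset (Finset ι)) :=
    {A ∈ F.powerset | (A : Set (Finset ι)).Pairwise fun f g ↦ r < #(f ∆ g)}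
  obtain ⟨A, -, hA, hmax⟩ := separated.exists_le_maximal (a := ∅) (by simp [separated])
  obtain ⟨hAF, hsep⟩ := mem_filter.1 hA
  rw [mem_powerset] at hAF
  refine ⟨A, hAF, hsep, fun f hf ↦ ?_⟩
  by_contra! hfar
  have hinsert : insert f A ∈ separated := by
    refine mem_filter.2 ⟨mem_powerset.2 (insert_subset hf hAF), ?_⟩
    rw [coe_insert]
    exact hsep.insert fun g hg _ ↦ ⟨hfar g hg, by simpa only [symmDiff_comm] using hfar g hg⟩
  have hfA : f ∈ A := hmax hinsert (subset_insert f A) (mem_insert_self f A)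
  have := hfar f hfA
  rw [symmDiff_self, bot_eq_empty, card_empty, Nat.cast_zero] at this
  exact hr.not_gt this

variable [Fintype ι]

/-- A form of the Sauer–Shelah lemma: the shattered sets `s` have at most `V` elements, so each
contributes at least `x ^ V` to `∑ x ^ #s = (1 + x) ^ n`. -/
lemma card_mul_pow_le_of_vcDim_le (F : Finset (Finset ι)) {V : ℕ} (hF : F.vcDim ≤ V) {x : ℝ}
    (hx0 : 0 ≤ x) (hx1 : x ≤ 1) : #F * x ^ V ≤ (1 + x) ^ Fintype.card ι :=
  calc (#F : ℝ) * x ^ V ≤ #F.shatterer * x ^ V := by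
        have : (#F : ℝ) ≤ #F.shatterer := by exact_mod_cast F.card_le_card_shatterer
        gcongr
    _ = ∑ _s ∈ F.shatterer, x ^ V := by rw [sum_const, nsmul_eq_mul]
    _ ≤ ∑ s ∈ F.shatterer, x ^ #s := sum_le_sum fun s hs ↦
        pow_le_pow_of_le_one hx0 hx1 ((mem_shatterer.1 hs).card_le_vcDim.trans hF)
    _ ≤ ∑ s : Finset ι, x ^ #s := sum_le_univ_sum_of_nonneg fun s ↦ by positivity
    _ = (1 + x) ^ Fintype.card ι := by
        simpa [add_comm] using Fintype.sum_pow_mul_eq_add_pow ι x 1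

lemma card_le_pow_of_vcDim_le (F : Finset (Finset ι)) {V : ℕ} (hV : 0 < V) (hF : F.vcDim ≤ V) :
    (#F : ℝ) ≤ (Real.exp 1 * (1 + Fintype.card ι / V)) ^ V := by
  set n := Fintype.card ι
  have : (0 : ℝ) < V := by exact_mod_cast hV
  set x : ℝ := V / (V + n) with hx
  have hxn : n * x ≤ V := by
    rw [hx, mul_div_assoc', div_le_iff₀ (by positivity)]
    nlinarith
  have hbound : #F * x ^ V ≤ Real.exp 1 ^ V :=
    calc #F * x ^ V ≤ (1 + x) ^ n := card_mul_pow_le_of_vcDim_le F hF (by positivity)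
          (div_le_one_of_le₀ (by simp) (by positivity))
      _ ≤ Real.exp x ^ n := by
          gcongr
          linarith [Real.add_one_le_exp x]
      _ ≤ Real.exp 1 ^ V := by
          rw [← Real.exp_nat_mul, ← Real.exp_nat_mul, mul_one]
          exact Real.exp_le_exp.2 hxn
  have hx_inv : 1 + n / V = x⁻¹ := by rw [hx]; field_simp
  rwa [hx_inv, mul_pow, inv_pow, ← div_eq_mul_inv, le_div_iff₀ (by positivity)]

lemma card_piFinset_compl_le (S : Finset ι) {e : ℝ} (hS : e * Fintype.card ι ≤ #S) (k : ℕ) :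
    (#(Fintype.piFinset fun _ : Fin k ↦ Sᶜ) : ℝ)
      ≤ Fintype.card ι ^ k * Real.exp (-(e * k)) := by
  have hcompl : (#Sᶜ : ℝ) ≤ Fintype.card ι * Real.exp (-e) := by
    rw [card_compl, Nat.cast_sub (card_le_univ S)]
    nlinarith [Real.add_one_le_exp (-e), Nat.cast_nonneg (α := ℝ) (Fintype.card ι)]
  rw [Fintype.card_piFinset, prod_const, card_univ, Fintype.card_fin, Nat.cast_pow]
  calc (#Sᶜ : ℝ) ^ k ≤ (Fintype.card ι * Real.exp (-e)) ^ k := by gcongr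
    _ = Fintype.card ι ^ k * Real.exp (-(e * k)) := by
        rw [mul_pow, ← Real.exp_nat_mul]
        ring_nf

/-- The probabilistic method: `k` uniform points fail to distinguish two `e n`-separated sets with
probability at most `exp (-e k)`. -/
lemma exists_injOn_trace [Nonempty ι] (F : Finset (Finset ι)) {e : ℝ}
    (hsep : (F : Set (Finset ι)).Pairwise fun f g ↦ e * Fintype.card ι ≤ #(f ∆ g)) {k : ℕ}
    (hk : (#F : ℝ) ^ 2 < Real.exp (e * k)) :
    ∃ p : Fin k → ι, Set.InjOn (fun f : Finset ι ↦ indexTrace p f) F := by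
  set n := Fintype.card ι
  by_contra! hcon
  have hcover : (univ : Finset (Fin k → ι)) ⊆
      F.offDiag.biUnion fun q ↦ Fintype.piFinset fun _ ↦ (q.1 ∆ q.2)ᶜ := by
    intro p _
    obtain ⟨f, hf, g, hg, hfg, hne⟩ :
        ∃ f ∈ F, ∃ g ∈ F, indexTrace p f = indexTrace p g ∧ f ≠ g := by
      simpa [Set.InjOn] using hcon p
    refine mem_biUnion.2 ⟨(f, g), mem_offDiag.2 ⟨hf, hg, hne⟩, Fintype.mem_piFinset.2 fun j ↦ ?_⟩
    have hj : p j ∈ f ↔ p j ∈ g := by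
      rw [← mem_coe, ← mem_indexTrace, hfg, mem_indexTrace, mem_coe]
    simp only [mem_compl, mem_symmDiff]
    tauto
  have hunion : (n : ℝ) ^ k ≤ #F ^ 2 * (n ^ k * Real.exp (-(e * k))) :=
    calc (n : ℝ) ^ k
        ≤ ∑ q ∈ F.offDiag, (#(Fintype.piFinset fun _ : Fin k ↦ (q.1 ∆ q.2)ᶜ) : ℝ) := by
          have := (card_le_card hcover).trans card_biUnion_le
          rw [card_univ, Fintype.card_fun, Fintype.card_fin] at this
          exact_mod_cast this
      _ ≤ #F.offDiag • (n ^ k * Real.exp (-(e * k))) := sum_le_card_nsmul _ _ _ fun q hq ↦ by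
          obtain ⟨hf, hg, hne⟩ := mem_offDiag.1 hq
          exact card_piFinset_compl_le _ (hsep hf hg hne) k
      _ ≤ #F ^ 2 * (n ^ k * Real.exp (-(e * k))) := by
          rw [nsmul_eq_mul]
          gcongr
          rw [offDiag_card, sq]
          exact_mod_cast Nat.sub_le _ _
  have hn : (0 : ℝ) < n ^ k := pow_pos (by exact_mod_cast Fintype.card_pos) k
  rw [Real.exp_neg, mul_left_comm, ← div_eq_mul_inv] at hunion
  nlinarith [(div_lt_one (Real.exp_pos _)).2 hk]

lemma le_mul_of_exp_le {l q : ℝ} (hq : 1 ≤ q)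
    (h : Real.exp l ≤ Real.exp 1 * (2 * l * q ^ 2 + 2)) : l ≤ 12 * q := by
  by_contra! hlq
  have hl : 12 ≤ l := by linarith
  have hcube : l ^ 3 / 6 ≤ Real.exp l := by
    simpa [Nat.factorial] using Real.pow_div_factorial_le_exp l (by linarith) 3
  have hsq : q ^ 2 ≤ l ^ 2 / 144 := by nlinarith
  have hl3 : (12 : ℝ) ^ 3 ≤ l ^ 3 := by gcongr
  have hsmall : 2 * l * q ^ 2 + 2 ≤ l ^ 3 / 24 := by nlinarith
  nlinarith [Real.exp_one_lt_d9, Real.exp_pos 1]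

/-- Enough random points keep the members of `F` distinct, and the Sauer–Shelah lemma bounds the
trace on these points. -/
lemma exists_card_le_pow_of_separated [Nonempty ι] (F : Finset (Finset ι)) {V : ℕ} (hV : 0 < V)
    (hF : F.vcDim ≤ V) {q : ℝ} (hq : 0 < q)
    (hsep : (F : Set (Finset ι)).Pairwise fun f g ↦ Fintype.card ι ≤ q ^ 2 * #(f ∆ g)) :
    ∃ k : ℕ, k ≤ 2 * Real.log #F * q ^ 2 + 1 ∧ (#F : ℝ) ≤ (Real.exp 1 * (1 + k / V)) ^ V := by
  rcases F.eq_empty_or_nonempty with rfl | hne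
  · exact ⟨0, by simp, by simpa using by positivity⟩
  have hcard : (1 : ℝ) ≤ #F := by exact_mod_cast hne.card_pos
  have : 0 ≤ Real.log #F := Real.log_nonneg hcard
  set k : ℕ := ⌊2 * Real.log #F * q ^ 2⌋₊ + 1 with hk
  have hk_gt : 2 * Real.log #F * q ^ 2 < k := by
    rw [hk, Nat.cast_add_one]
    exact Nat.lt_floor_add_one _
  have hk_le : (k : ℝ) ≤ 2 * Real.log #F * q ^ 2 + 1 := by
    rw [hk, Nat.cast_add_one]
    gcongr
    exact Nat.floor_le (by positivity)
  obtain ⟨p, hp⟩ : ∃ p : Fin k → ι, Set.InjOn (fun f : Finset ι ↦ indexTrace p f) F := by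
    refine exists_injOn_trace F (e := 1 / q ^ 2) (fun f hf g hg hfg ↦ ?_) ?_
    · beta_reduce
      rw [one_div_mul_eq_div, div_le_iff₀' (by positivity)]
      exact hsep hf hg hfg
    · rw [← Real.log_lt_iff_lt_exp (by positivity), Real.log_pow, one_div_mul_eq_div,
        lt_div_iff₀ (by positivity)]
      exact_mod_cast hk_gt
  have htrace := card_le_pow_of_vcDim_le _ hV ((vcDim_image_indexTrace_le p F).trans hF)
  rw [card_image_of_injOn hp, Fintype.card_fin] at htrace
  exact ⟨k, hk_le, htrace⟩

/-- Dudley's bound on packing numbers. -/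
lemma log_card_le_of_separated [Nonempty ι] (F : Finset (Finset ι)) {V : ℕ} (hV : 0 < V)
    (hF : F.vcDim ≤ V) {q : ℝ} (hq : 1 ≤ q)
    (hsep : (F : Set (Finset ι)).Pairwise fun f g ↦ Fintype.card ι ≤ q ^ 2 * #(f ∆ g)) :
    Real.log #F ≤ 12 * V * q := by
  rcases F.eq_empty_or_nonempty with rfl | hne
  · simpa using by positivity
  have hcard : (0 : ℝ) < #F := by exact_mod_cast hne.card_pos
  have hV' : (1 : ℝ) ≤ V := by exact_mod_cast hV
  obtain ⟨k, hk, htrace⟩ := exists_card_le_pow_of_separated F hV hF (by linarith) hsep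
  have hroot : Real.exp (Real.log #F / V) ≤ Real.exp 1 * (1 + k / V) := by
    rw [← pow_le_pow_iff_left₀ (Real.exp_pos _).le (by positivity) hV.ne', ← Real.exp_nat_mul,
      mul_div_cancel₀ _ (by positivity), Real.exp_log hcard]
    exact htrace
  have hkV : k / V ≤ 2 * (Real.log #F / V) * q ^ 2 + 1 := by
    rw [div_le_iff₀ (by positivity)]
    calc (k : ℝ) ≤ 2 * Real.log #F * q ^ 2 + V := by linarith
      _ = (2 * (Real.log #F / V) * q ^ 2 + 1) * V := by field_simp
  have hfinal : Real.log #F / V ≤ 12 * q :=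
    le_mul_of_exp_le hq (hroot.trans
      (mul_le_mul_of_nonneg_left (by linarith) (Real.exp_pos 1).le))
  rw [div_le_iff₀ (by positivity)] at hfinal
  linarith

end VCDimension

section Chaining

open Finset
open scoped symmDiff

variable {ι : Type*} [Fintype ι] [DecidableEq ι]

/-- The membership vectors of a set family `A`, indexed by points: the `i`-th vector has as its
coordinates the values at `i` of the indicator functions of the members of `A`. -/
def memberVec (A : Finset (Finset ι)) (i : ι) (f : A) : ℝ := if i ∈ f.1 then 1 else 0

lemma sum_sq_memberVec_le (A : Finset (Finset ι)) (f : A) :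
    ∑ i, memberVec A i f ^ 2 ≤ Fintype.card ι := by
  simpa [memberVec, ite_pow] using card_le_univ f.1

lemma sum_sq_memberVec_sub {A B : Finset (Finset ι)} (f : A) (g : B) :
    ∑ i, (memberVec A i f - memberVec B i g) ^ 2 = #(f.1 ∆ g.1) := by
  have sq_sub_eq (i : ι) :
      (memberVec A i f - memberVec B i g) ^ 2 = if i ∈ f.1 ∆ g.1 then 1 else 0 := by
    by_cases hf : i ∈ f.1 <;> by_cases hg : i ∈ g.1 <;> simp [memberVec, mem_symmDiff, hf, hg]
  simp [sq_sub_eq]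

lemma rademacherAverage_memberVec_le_add {A B : Finset (Finset ι)} {r L : ℝ} (hr : 0 < r)
    (hL : 0 < L) (hcard : Real.log (2 * #B) ≤ L)
    (hnet : ∀ f ∈ B, ∃ g ∈ A, (#(f ∆ g) : ℝ) ≤ r) :
    rademacherAverage (memberVec B) ≤ rademacherAverage (memberVec A) + √(2 * r * L) := by
  choose! p hpA hp using hnet
  let q : B → A := fun f ↦ ⟨p f, hpA f f.2⟩
  let rest : ι → B → ℝ := fun i f ↦ memberVec B i f - memberVec A i (q f)
  calc rademacherAverage (memberVec B)
      = rademacherAverage ((fun i ↦ memberVec A i ∘ q) + rest) := by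
        congr 1
        ext i f
        simp [rest]
    _ ≤ rademacherAverage (fun i ↦ memberVec A i ∘ q) + rademacherAverage rest :=
        rademacherAverage_add_le _ _
    _ ≤ rademacherAverage (memberVec A) + √(2 * r * L) := by
        refine add_le_add (rademacherAverage_comp_le q _)
          (rademacherAverage_le_sqrt rest hr hL (fun f ↦ ?_) (by rwa [Fintype.card_coe]))
        rw [sum_sq_memberVec_sub]
        exact hp f f.2

lemma rademacherAverage_memberVec_le_of_card_le_one [Nonempty ι] {A : Finset (Finset ι)}
    (hA : #A ≤ 1) : rademacherAverage (memberVec A) ≤ 2 * √(Fintype.card ι) := by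
  have hlog : Real.log (2 * Fintype.card A) ≤ 1 := by
    rw [Fintype.card_coe]
    interval_cases #A
    · simp
    · norm_num
      linarith [Real.log_two_lt_d9]
  calc rademacherAverage (memberVec A) ≤ √(2 * Fintype.card ι * 1) :=
        rademacherAverage_le_sqrt _ (by positivity) one_pos (sum_sq_memberVec_le A) hlog
    _ ≤ √(2 ^ 2 * Fintype.card ι) :=
        Real.sqrt_le_sqrt (by linarith [Nat.cast_nonneg (α := ℝ) (Fintype.card ι)])
    _ = 2 * √(Fintype.card ι) := by
        rw [Real.sqrt_mul (by positivity), Real.sqrt_sq (by norm_num)]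

lemma log_two_mul_card_le_of_separated [Nonempty ι] {A : Finset (Finset ι)} {V k : ℕ}
    (hV : 0 < V) (hA : A.vcDim ≤ V)
    (hsep : (A : Set (Finset ι)).Pairwise fun f g ↦ Fintype.card ι / 16 ^ k < (#(f ∆ g) : ℝ)) :
    Real.log (2 * #A) ≤ 13 * V * 4 ^ k := by
  have hlog : Real.log #A ≤ 12 * V * 4 ^ k := by
    refine log_card_le_of_separated A hV hA (one_le_pow₀ (by norm_num)) fun f hf g hg hfg ↦ ?_
    have hfar := (hsep hf hg hfg).le
    rw [div_le_iff₀' (by positivity)] at hfar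
    rwa [← pow_mul, mul_comm k 2, pow_mul, show (4 : ℝ) ^ 2 = 16 by norm_num]
  have hV1 : (1 : ℝ) ≤ V * 4 ^ k :=
    one_le_mul_of_one_le_of_one_le (by exact_mod_cast hV) (one_le_pow₀ (by norm_num))
  rcases A.eq_empty_or_nonempty with rfl | hne
  · simp only [card_empty, Nat.cast_zero, mul_zero, Real.log_zero]
    positivity
  · have : (#A : ℝ) ≠ 0 := by exact_mod_cast hne.card_ne_zero
    rw [Real.log_mul two_ne_zero this]
    linarith [Real.log_two_lt_d9]

lemma sqrt_chaining_step_le {V n : ℝ} (hV : 0 ≤ V) (hn : 0 ≤ n) (k : ℕ) :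
    √(2 * (n / 16 ^ k) * (13 * V * 4 ^ (k + 1))) ≤ √(V * n) * (21 / 2 / 2 ^ k) := by
  have h4 : (4 : ℝ) ^ k = 2 ^ k * 2 ^ k := by rw [← mul_pow]; norm_num
  have h16 : (16 : ℝ) ^ k = 4 ^ k * 4 ^ k := by rw [← mul_pow]; norm_num
  rw [Real.sqrt_le_left (by positivity), mul_pow, Real.sq_sqrt (by positivity), pow_succ, h16, h4]
  field_simp
  nlinarith [mul_nonneg hn hV]

/-- Chaining over nets at the scales `n / 16 ^ k`. -/
lemma rademacherAverage_memberVec_le_of_separated [Nonempty ι] {F : Finset (Finset ι)} {V : ℕ}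
    (hV : 0 < V) (hF : F.vcDim ≤ V) (k : ℕ) : ∀ A ⊆ F,
    (A : Set (Finset ι)).Pairwise (fun f g ↦ Fintype.card ι / 16 ^ k < (#(f ∆ g) : ℝ)) →
    rademacherAverage (memberVec A) ≤ √(V * Fintype.card ι) * (2 + 21 * (1 - 1 / 2 ^ k)) := by
  induction k with
  | zero =>
    intro A _ hsep
    have hA : #A ≤ 1 := card_le_one.2 fun f hf g hg ↦ by
      by_contra hfg
      have hfar := hsep hf hg hfg
      rw [pow_zero, div_one, Nat.cast_lt] at hfar
      exact hfar.not_ge (card_le_univ _)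
    refine (rademacherAverage_memberVec_le_of_card_le_one hA).trans ?_
    rw [pow_zero, div_one, sub_self, mul_zero, add_zero, mul_comm]
    gcongr
    exact le_mul_of_one_le_left (Nat.cast_nonneg _) (by exact_mod_cast hV)
  | succ k ih =>
    intro A hAF hsep
    obtain ⟨A', hA'F, hsep', hnet⟩ :=
      exists_separated_net F (r := Fintype.card ι / 16 ^ k) (by positivity)
    calc rademacherAverage (memberVec A)
        ≤ rademacherAverage (memberVec A')
          + √(2 * (Fintype.card ι / 16 ^ k) * (13 * V * 4 ^ (k + 1))) :=
          rademacherAverage_memberVec_le_add (by positivity) (by positivity)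
            (log_two_mul_card_le_of_separated hV ((vcDim_mono hAF).trans hF) hsep)
            fun f hf ↦ hnet f (hAF hf)
      _ ≤ √(V * Fintype.card ι) * (2 + 21 * (1 - 1 / 2 ^ k))
          + √(V * Fintype.card ι) * (21 / 2 / 2 ^ k) :=
          add_le_add (ih A' hA'F hsep') (sqrt_chaining_step_le (by positivity) (by positivity) k)
      _ = √(V * Fintype.card ι) * (2 + 21 * (1 - 1 / 2 ^ (k + 1))) := by
          rw [pow_succ]
          field_simp
          ring

theorem rademacherAverage_memberVec_le_of_vcDim_le {F : Finset (Finset ι)} {V : ℕ} (hV : 0 < V)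
    (hF : F.vcDim ≤ V) : rademacherAverage (memberVec F) ≤ 23 * √(V * Fintype.card ι) := by
  cases isEmpty_or_nonempty ι
  · simp [rademacherAverage]
  have hsep : (F : Set (Finset ι)).Pairwise fun f g ↦
      Fintype.card ι / 16 ^ Fintype.card ι < (#(f ∆ g) : ℝ) := fun f _ g _ hfg ↦ by
    have hpos : 1 ≤ #(f ∆ g) :=
      card_pos.2 (nonempty_iff_ne_empty.2 fun h ↦ hfg (symmDiff_eq_bot.1 h))
    calc (Fintype.card ι / 16 ^ Fintype.card ι : ℝ) < 1 := by
          rw [div_lt_one (by positivity)]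
          exact_mod_cast Nat.lt_pow_self (by norm_num)
      _ ≤ #(f ∆ g) := by exact_mod_cast hpos
  calc rademacherAverage (memberVec F)
      ≤ √(V * Fintype.card ι) * (2 + 21 * (1 - 1 / 2 ^ Fintype.card ι)) :=
        rademacherAverage_memberVec_le_of_separated hV hF _ F subset_rfl hsep
    _ ≤ √(V * Fintype.card ι) * 23 := by
        gcongr
        have : (0 : ℝ) ≤ 1 / 2 ^ Fintype.card ι := by positivity
        linarith
    _ = 23 * √(V * Fintype.card ι) := mul_comm _ _

end Chaining

section Halfspace

variable {ι E : Type*} [Fintype ι] [NormedAddCommGroup E] [InnerProductSpace ℝ E]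

/-- The set of indices of the points `x i` in the half-space `⟪v, · - μ⟫ ≥ s`. -/
noncomputable def halfspacePattern (x : ι → E) (μ : E) (s : ℝ) (v : E) : Finset ι :=
  indexTrace x {z | s ≤ inner ℝ v (z - μ)}

@[simp] lemma mem_halfspacePattern {x : ι → E} {μ : E} {s : ℝ} {v : E} {i : ι} :
    i ∈ halfspacePattern x μ s v ↔ s ≤ inner ℝ v (x i - μ) := by
  simp [halfspacePattern]

lemma vcDim_le_finrank_add_one [DecidableEq ι] [FiniteDimensional ℝ E] (x : ι → E)
    {F : Finset (Finset ι)} (hF : ∀ f ∈ F, ∃ μ s v, halfspacePattern x μ s v = f) :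
    F.vcDim ≤ Module.finrank ℝ E + 1 := by
  refine Finset.sup_le fun S hS ↦ ?_
  rw [Finset.mem_shatterer] at hS
  by_contra! hcard
  have hdep : ¬ AffineIndependent ℝ fun i : S ↦ x i := fun h ↦ by
    have hle := h.card_le_finrank_succ
    rw [Fintype.card_coe] at hle
    have := Submodule.finrank_le (vectorSpan ℝ (Set.range fun i : S ↦ x i))
    omega
  obtain ⟨J, y, hyJ, hyJc⟩ := Convex.radon_partition hdep
  classical
  obtain ⟨u, hu, hut⟩ := hS (t := S.filter fun i ↦ ∃ h : i ∈ S, (⟨i, h⟩ : S) ∈ J)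
    (Finset.filter_subset _ _)
  obtain ⟨μ, s, v, rfl⟩ := hF u hu
  have le_inner_iff (i : S) : s + inner ℝ v μ ≤ inner ℝ v (x i) ↔ i ∈ J := by
    rw [← le_sub_iff_add_le, ← inner_sub_right]
    simpa using Finset.ext_iff.1 hut i
  have hJ : convexHull ℝ ((fun i : S ↦ x i) '' J) ⊆ {z | s + inner ℝ v μ ≤ inner ℝ v z} := by
    refine convexHull_min ?_ (convex_halfSpace_ge (innerSL ℝ v).toLinearMap.isLinear _)
    rintro _ ⟨i, hi, rfl⟩
    exact (le_inner_iff i).2 hi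
  have hJc : convexHull ℝ ((fun i : S ↦ x i) '' Jᶜ) ⊆ {z | inner ℝ v z < s + inner ℝ v μ} := by
    refine convexHull_min ?_ (convex_halfSpace_lt (innerSL ℝ v).toLinearMap.isLinear _)
    rintro _ ⟨i, hi, rfl⟩
    exact not_le.1 fun h ↦ hi ((le_inner_iff i).1 h)
  exact not_le.2 (show inner ℝ v y < s + inner ℝ v μ from hJc hyJc) (hJ hyJ)

end Halfspace

section Symmetrization

open Finset
open scoped BigOperators

variable {ι E W : Type*} [Fintype ι] [MeasurableSpace E] [NormedAddCommGroup W]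

lemma integral_norm_sum_units_smul_eq (Q : Measure E) [SigmaFinite Q] {T : E ≃ᵐ E}
    (hT : MeasurePreserving T Q Q) {g : E → W} (hg : ∀ x, g (T x) = -g x) (ε : ι → ℤˣ) :
    ∫ z, ‖∑ i, ε i • g (z i)‖ ∂(Measure.pi fun _ : ι ↦ Q)
      = ∫ z, ‖∑ i, g (z i)‖ ∂(Measure.pi fun _ : ι ↦ Q) := by
  let flip (u : ℤˣ) : E ≃ᵐ E := if u = 1 then .refl E else T
  have hflip : MeasurePreserving (MeasurableEquiv.piCongrRight fun i ↦ flip (ε i))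
      (Measure.pi fun _ : ι ↦ Q) (Measure.pi fun _ : ι ↦ Q) := by
    refine measurePreserving_pi _ _ fun i ↦ ?_
    rcases Int.units_eq_one_or (ε i) with h | h
    · simpa [flip, h] using MeasurePreserving.id Q
    · simpa [flip, h] using hT
  rw [← hflip.integral_comp']
  refine integral_congr_ae (ae_of_all _ fun z ↦ congrArg norm (sum_congr rfl fun i _ ↦ ?_))
  change ε i • g (flip (ε i) (z i)) = g (z i)
  rcases Int.units_eq_one_or (ε i) with h | h <;> simp [flip, h, hg]

lemma integrable_units_smul {ν : Measure E} {g : E → W} (hg : Integrable g ν) (u : ℤˣ) :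
    Integrable (fun x ↦ u • g x) ν := by
  rcases Int.units_eq_one_or u with rfl | rfl
  · simpa using hg
  · simpa using hg.neg

lemma integrable_norm_sum_units_smul {Q : Measure E} [IsProbabilityMeasure Q] {g : E → W}
    (hg : Integrable g Q) (ε : ι → ℤˣ) :
    Integrable (fun z : ι → E ↦ ‖∑ i, ε i • g (z i)‖) (Measure.pi fun _ : ι ↦ Q) :=
  (integrable_finsetSum _ fun _ _ ↦ integrable_units_smul (integrable_comp_eval hg) _).norm

lemma integrable_rademacherAverage [DecidableEq ι] {Q : Measure E} [IsProbabilityMeasure Q]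
    {g : E → W} (hg : Integrable g Q) :
    Integrable (fun z : ι → E ↦ rademacherAverage (g ∘ z)) (Measure.pi fun _ : ι ↦ Q) := by
  simp only [rademacherAverage, Fintype.expect_eq_sum_div_card]
  exact (integrable_finsetSum _ fun ε _ ↦ integrable_norm_sum_units_smul hg ε).div_const _

lemma integral_norm_sum_eq_integral_rademacherAverage [DecidableEq ι] {Q : Measure E}
    [IsProbabilityMeasure Q] {T : E ≃ᵐ E} (hT : MeasurePreserving T Q Q) {g : E → W}
    (hgT : ∀ x, g (T x) = -g x) (hg : Integrable g Q) :
    ∫ z, ‖∑ i, g (z i)‖ ∂(Measure.pi fun _ : ι ↦ Q)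
      = ∫ z, rademacherAverage (g ∘ z) ∂(Measure.pi fun _ : ι ↦ Q) :=
  calc ∫ z, ‖∑ i, g (z i)‖ ∂(Measure.pi fun _ : ι ↦ Q)
      = 𝔼 ε : ι → ℤˣ, ∫ z, ‖∑ i, ε i • g (z i)‖ ∂(Measure.pi fun _ : ι ↦ Q) := by
        simp_rw [integral_norm_sum_units_smul_eq Q hT hgT, Fintype.expect_const]
    _ = ∫ z, rademacherAverage (g ∘ z) ∂(Measure.pi fun _ : ι ↦ Q) := by
        simp only [rademacherAverage, Fintype.expect_eq_sum_div_card, Function.comp_apply]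
        rw [integral_div, integral_finsetSum _ fun ε _ ↦ integrable_norm_sum_units_smul hg ε]

variable [NormedSpace ℝ W] {P : Measure E} [IsProbabilityMeasure P] {φ : E → W}

/-- Jensen's inequality for the expectation over an independent ghost sample. -/
lemma norm_sum_sub_card_smul_integral_le [CompleteSpace W] (hφ : Integrable φ P) (x : ι → E) :
    ‖∑ i, φ (x i) - Fintype.card ι • ∫ y, φ y ∂P‖
      ≤ ∫ y, ‖∑ i, (φ (x i) - φ (y i))‖ ∂(Measure.pi fun _ : ι ↦ P) := by
  have heval (i : ι) : Integrable (fun y : ι → E ↦ φ (y i)) (Measure.pi fun _ : ι ↦ P) :=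
    integrable_comp_eval hφ
  have hmean : ∑ i, φ (x i) - Fintype.card ι • ∫ y, φ y ∂P
      = ∫ y, ∑ i, (φ (x i) - φ (y i)) ∂(Measure.pi fun _ : ι ↦ P) := by
    rw [integral_finsetSum (f := fun i (y : ι → E) ↦ φ (x i) - φ (y i)) _
      fun i _ ↦ (integrable_const _).sub (heval i)]
    simp_rw [integral_sub (integrable_const _) (heval _), integral_const, probReal_univ, one_smul,
      integral_comp_eval (μ := fun _ : ι ↦ P) hφ.aestronglyMeasurable, sum_sub_distrib, sum_const,
      card_univ]
  rw [hmean]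
  exact norm_integral_le_integral_norm _

lemma integral_norm_sum_sub_le_integral_pi_prod [CompleteSpace W] (hφ : Integrable φ P) :
    ∫ x, ‖∑ i, φ (x i) - Fintype.card ι • ∫ y, φ y ∂P‖ ∂(Measure.pi fun _ : ι ↦ P)
      ≤ ∫ z, ‖∑ i, (φ (z i).1 - φ (z i).2)‖ ∂(Measure.pi fun _ : ι ↦ P.prod P) := by
  set m := Measure.pi fun _ : ι ↦ P
  have hpair : Integrable (fun q : (ι → E) × (ι → E) ↦ ‖∑ i, (φ (q.1 i) - φ (q.2 i))‖)
      (m.prod m) := by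
    refine (integrable_finsetSum _ fun i _ ↦ ?_).norm
    exact ((integrable_comp_eval hφ).comp_fst m).sub ((integrable_comp_eval hφ).comp_snd m)
  calc ∫ x, ‖∑ i, φ (x i) - Fintype.card ι • ∫ y, φ y ∂P‖ ∂m
      ≤ ∫ x, ∫ y, ‖∑ i, (φ (x i) - φ (y i))‖ ∂m ∂m :=
        integral_mono_of_nonneg (ae_of_all _ fun _ ↦ norm_nonneg _) hpair.integral_prod_left
          (ae_of_all _ (norm_sum_sub_card_smul_integral_le hφ))
    _ = ∫ q, ‖∑ i, (φ (q.1 i) - φ (q.2 i))‖ ∂(m.prod m) := (integral_prod _ hpair).symm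
    _ = ∫ z, ‖∑ i, (φ (z i).1 - φ (z i).2)‖ ∂(Measure.pi fun _ : ι ↦ P.prod P) :=
        ((measurePreserving_arrowProdEquivProdArrow E E ι (fun _ ↦ P) fun _ ↦ P).integral_comp'
          fun q : (ι → E) × (ι → E) ↦ ‖∑ i, (φ (q.1 i) - φ (q.2 i))‖).symm

theorem integral_norm_sum_sub_le_two_mul_rademacherAverage [DecidableEq ι] [CompleteSpace W]
    (hφ : Integrable φ P) :
    ∫ x, ‖∑ i, φ (x i) - Fintype.card ι • ∫ y, φ y ∂P‖ ∂(Measure.pi fun _ : ι ↦ P)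
      ≤ 2 * ∫ x, rademacherAverage (φ ∘ x) ∂(Measure.pi fun _ : ι ↦ P) := by
  set m := Measure.pi fun _ : ι ↦ P
  set m₂ := Measure.pi fun _ : ι ↦ P.prod P
  have hΔ : Integrable (fun z : E × E ↦ φ z.1 - φ z.2) (P.prod P) :=
    (hφ.comp_fst P).sub (hφ.comp_snd P)
  have hrad := integrable_rademacherAverage (ι := ι) hφ
  have hmarginal {π : (ι → E × E) → ι → E} (hπ : MeasurePreserving π m₂ m) :
      Integrable (fun z ↦ rademacherAverage (φ ∘ π z)) m₂ ∧
        ∫ z, rademacherAverage (φ ∘ π z) ∂m₂ = ∫ x, rademacherAverage (φ ∘ x) ∂m := by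
    refine ⟨hπ.integrable_comp_of_integrable hrad, ?_⟩
    rw [← hπ.map_eq, integral_map hπ.aemeasurable (hπ.map_eq ▸ hrad.aestronglyMeasurable)]
  obtain ⟨hfst, integral_fst⟩ := hmarginal (π := fun z i ↦ (z i).1)
    (measurePreserving_pi _ _ fun _ ↦ measurePreserving_fst)
  obtain ⟨hsnd, integral_snd⟩ := hmarginal (π := fun z i ↦ (z i).2)
    (measurePreserving_pi _ _ fun _ ↦ measurePreserving_snd)
  calc ∫ x, ‖∑ i, φ (x i) - Fintype.card ι • ∫ y, φ y ∂P‖ ∂m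
      ≤ ∫ z, ‖∑ i, (φ (z i).1 - φ (z i).2)‖ ∂m₂ := integral_norm_sum_sub_le_integral_pi_prod hφ
    _ = ∫ z, rademacherAverage ((φ ∘ fun i ↦ (z i).1) + -(φ ∘ fun i ↦ (z i).2)) ∂m₂ := by
        simp_rw [← sub_eq_add_neg]
        exact integral_norm_sum_eq_integral_rademacherAverage (T := MeasurableEquiv.prodComm)
          Measure.measurePreserving_swap (fun z ↦ (neg_sub (φ z.1) (φ z.2)).symm) hΔ
    _ ≤ ∫ z, (rademacherAverage (φ ∘ fun i ↦ (z i).1) + rademacherAverage (φ ∘ fun i ↦ (z i).2))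
          ∂m₂ := by
        refine integral_mono_of_nonneg (ae_of_all _ fun z ↦ rademacherAverage_nonneg _)
          (hfst.add hsnd) (ae_of_all _ fun z ↦ (rademacherAverage_add_le _ _).trans_eq ?_)
        rw [rademacherAverage_neg]
    _ = 2 * ∫ x, rademacherAverage (φ ∘ x) ∂m := by
        rw [integral_add hfst hsnd, integral_fst, integral_snd, two_mul]

end Symmetrization

section UniformDeviation

open Finset

variable {ι τ E : Type*} [Fintype ι]

lemma rademacherAverage_indicator_le [DecidableEq ι] [Fintype τ] {A : τ → Set E} {x : ι → E}
    {V : ℕ} (hV : 0 < V) (hA : (univ.image fun t ↦ indexTrace x (A t)).vcDim ≤ V) :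
    rademacherAverage (fun i t ↦ (A t).indicator (1 : E → ℝ) (x i))
      ≤ 23 * √(V * Fintype.card ι) := by
  set F := univ.image fun t ↦ indexTrace x (A t)
  let p (t : τ) : F := ⟨indexTrace x (A t), mem_image_of_mem _ (mem_univ t)⟩
  calc rademacherAverage (fun i t ↦ (A t).indicator (1 : E → ℝ) (x i))
      = rademacherAverage (fun i ↦ memberVec F i ∘ p) := by
        congr 1
        ext i t
        by_cases h : x i ∈ A t <;> simp [memberVec, p, h]
    _ ≤ rademacherAverage (memberVec F) := rademacherAverage_comp_le p _
    _ ≤ 23 * √(V * Fintype.card ι) := rademacherAverage_memberVec_le_of_vcDim_le hV hA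

theorem measure_exists_card_indexTrace_lt_le [DecidableEq ι] [Fintype τ] [MeasurableSpace E]
    (P : Measure E) [IsProbabilityMeasure P] {A : τ → Set E} (hA : ∀ t, MeasurableSet (A t))
    {V : ℕ} (hV : 0 < V) (hvc : ∀ x : ι → E, (univ.image fun t ↦ indexTrace x (A t)).vcDim ≤ V)
    {e : ℝ} (he : 0 < e) :
    (Measure.pi fun _ : ι ↦ P)
        {x | ∃ t, (#(indexTrace x (A t)) : ℝ) < Fintype.card ι * P.real (A t) - e}
      ≤ ENNReal.ofReal (46 * √(V * Fintype.card ι) / e) := by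
  set m := Measure.pi fun _ : ι ↦ P
  let φ (y : E) (t : τ) : ℝ := (A t).indicator 1 y
  have hφt (t : τ) : Integrable (φ · t) P := (integrable_const 1).indicator (hA t)
  have hφ : Integrable φ P := Integrable.of_eval hφt
  let D (x : ι → E) : τ → ℝ := ∑ i, φ (x i) - Fintype.card ι • ∫ y, φ y ∂P
  have hD (x : ι → E) (t : τ) : D x t = #(indexTrace x (A t)) - Fintype.card ι * P.real (A t) := by
    have hcount : ∑ i, φ (x i) t = #(indexTrace x (A t)) := by
      simp [φ, Set.indicator, indexTrace]
    simp [D, hcount, eval_integral hφt, φ, integral_indicator_one (hA t)]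
  have hD_int : Integrable (fun x ↦ ‖D x‖) m :=
    ((integrable_finsetSum _ fun i _ ↦ integrable_comp_eval hφ).sub (integrable_const _)).norm
  have hmean : ∫ x, ‖D x‖ ∂m ≤ 46 * √(V * Fintype.card ι) :=
    calc ∫ x, ‖D x‖ ∂m ≤ 2 * ∫ x, rademacherAverage (φ ∘ x) ∂m :=
          integral_norm_sum_sub_le_two_mul_rademacherAverage hφ
      _ ≤ 2 * ∫ _x, 23 * √(V * Fintype.card ι) ∂m := by
          exact mul_le_mul_of_nonneg_left (integral_mono (integrable_rademacherAverage hφ)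
            (integrable_const _) fun x ↦ rademacherAverage_indicator_le hV (hvc x)) zero_le_two
      _ = 46 * √(V * Fintype.card ι) := by
          rw [integral_const, probReal_univ, one_smul]
          ring
  have hsub : {x | ∃ t, (#(indexTrace x (A t)) : ℝ) < Fintype.card ι * P.real (A t) - e}
      ⊆ {x | e ≤ ‖D x‖} := by
    rintro x ⟨t, ht⟩
    have hcoord := neg_le_of_abs_le (norm_le_pi_norm (D x) t)
    rw [hD] at hcoord
    simp only [Set.mem_ofPred_eq]
    linarith
  have hmarkov := mul_meas_ge_le_integral_of_nonneg (ae_of_all _ fun x ↦ norm_nonneg (D x)) hD_int e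
  refine (measure_mono hsub).trans ?_
  rw [ENNReal.le_ofReal_iff_toReal_le (measure_ne_top _ _) (by positivity), le_div_iff₀' he]
  exact hmarkov.trans hmean

variable [NormedAddCommGroup E] [InnerProductSpace ℝ E]

lemma isClosed_le_card_halfspacePattern (μ : E) (s a : ℝ) :
    IsClosed {q : (ι → E) × E | a ≤ #(halfspacePattern q.1 μ s q.2)} := by
  have eq_biUnion : {q : (ι → E) × E | a ≤ #(halfspacePattern q.1 μ s q.2)}
      = ⋃ T ∈ {T : Finset ι | a ≤ #T}, ⋂ i ∈ T, {q | s ≤ inner ℝ q.2 (q.1 i - μ)} := by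
    ext q
    simp only [Set.mem_ofPred_eq, Set.mem_iUnion, Set.mem_iInter, exists_prop]
    refine ⟨fun h ↦ ⟨_, h, fun i hi ↦ mem_halfspacePattern.1 hi⟩, fun ⟨T, hT, h⟩ ↦ hT.trans ?_⟩
    exact_mod_cast card_le_card fun i hi ↦ mem_halfspacePattern.2 (h i hi)
  rw [eq_biUnion]
  refine Set.Finite.isClosed_biUnion (Set.toFinite _) fun T _ ↦ isClosed_biInter fun i _ ↦ ?_
  exact isClosed_le continuous_const (by fun_prop)

/-- The datasets such that every half-space at signed distance `s` from `μ` holds at least `a`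
points, that is, such that `μ` has depth at least `a` when `s = 0`. -/
def uniformlyDeep (ι : Type*) [Fintype ι] (μ : E) (s a : ℝ) : Set (ι → E) :=
  {x | ∀ v : E, ‖v‖ = 1 → a ≤ #(halfspacePattern x μ s v)}

lemma isClosed_uniformlyDeep (μ : E) (s a : ℝ) : IsClosed (uniformlyDeep ι μ s a) := by
  have eq_iInter : uniformlyDeep ι μ s a = ⋂ (v : E) (_ : ‖v‖ = 1),
      (fun x ↦ (x, v)) ⁻¹' {q : (ι → E) × E | a ≤ #(halfspacePattern q.1 μ s q.2)} := by
    ext x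
    simp [uniformlyDeep]
  rw [eq_iInter]
  exact isClosed_iInter fun v ↦ isClosed_iInter fun _ ↦
    (isClosed_le_card_halfspacePattern μ s a).preimage (by fun_prop)

lemma mem_uniformlyDeep_of_dense {u : ℕ → Metric.sphere (0 : E) 1} (hu : DenseRange u) {x : ι → E}
    {μ : E} {s a : ℝ} (hx : ∀ k, a ≤ #(halfspacePattern x μ s (u k))) :
    x ∈ uniformlyDeep ι μ s a := by
  intro v hv
  have hclosed : IsClosed {w : Metric.sphere (0 : E) 1 | a ≤ #(halfspacePattern x μ s w)} :=
    (isClosed_le_card_halfspacePattern μ s a).preimage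
      (f := fun w : Metric.sphere (0 : E) 1 ↦ (x, (w : E))) (by fun_prop)
  exact hu.induction_on (p := fun w ↦ a ≤ #(halfspacePattern x μ s w)) ⟨v, by simpa using hv⟩
    hclosed hx

lemma measure_compl_uniformlyDeep_le [Nontrivial E] [FiniteDimensional ℝ E] [MeasurableSpace E]
    [BorelSpace E] (P : Measure E) [IsProbabilityMeasure P] {μ : E} {s p : ℝ}
    (hp : ∀ v : E, ‖v‖ = 1 → p ≤ P.real {x | s ≤ inner ℝ v (x - μ)}) {e : ℝ} (he : 0 < e) :
    (Measure.pi fun _ : ι ↦ P) (uniformlyDeep ι μ s (Fintype.card ι * p - e))ᶜ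
      ≤ ENNReal.ofReal (46 * √((Module.finrank ℝ E + 1 : ℕ) * Fintype.card ι) / e) := by
  classical
  have : Nonempty (Metric.sphere (0 : E) 1) :=
    (NormedSpace.sphere_nonempty.2 zero_le_one).to_subtype
  set u : ℕ → Metric.sphere (0 : E) 1 := TopologicalSpace.denseSeq _
  let U (m : ℕ) : Set (ι → E) := {x | ∃ k < m,
    (#(halfspacePattern x μ s (u k)) : ℝ) < Fintype.card ι * p - e}
  have hU_mono : Monotone U := fun _ _ hm _ ⟨k, hk, h⟩ ↦ ⟨k, hk.trans_le hm, h⟩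
  have hcover : (uniformlyDeep ι μ s (Fintype.card ι * p - e))ᶜ ⊆ ⋃ m, U m := by
    intro x hx
    by_contra hxU
    simp only [U, Set.mem_iUnion, Set.mem_ofPred_eq, not_exists, not_and, not_lt] at hxU
    exact hx (mem_uniformlyDeep_of_dense (TopologicalSpace.denseRange_denseSeq _)
      fun k ↦ hxU (k + 1) k k.lt_succ_self)
  refine (measure_mono hcover).trans ?_
  rw [hU_mono.measure_iUnion]
  refine iSup_le fun m ↦ le_trans (measure_mono ?_) (measure_exists_card_indexTrace_lt_le P
    (A := fun k : Fin m ↦ {z | s ≤ inner ℝ (u k : E) (z - μ)}) (fun k ↦ ?_)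
    (Nat.succ_pos _) (fun x ↦ vcDim_le_finrank_add_one x ?_) he)
  · rintro x ⟨k, hk, hlt⟩
    refine ⟨⟨k, hk⟩, hlt.trans_le ?_⟩
    gcongr
    exact hp _ (norm_eq_of_mem_sphere (u k))
  · exact (isClosed_le continuous_const (by fun_prop)).measurableSet
  · rintro f hf
    obtain ⟨k, -, rfl⟩ := mem_image.1 hf
    exact ⟨μ, s, u k, rfl⟩

end UniformDeviation

section GaussianTail

lemma half_le_gaussianReal_Ici_zero : 1 / 2 ≤ (gaussianReal 0 1).real (Set.Ici 0) := by
  have reflection : (gaussianReal 0 1).real (Set.Iic 0) = (gaussianReal 0 1).real (Set.Ici 0) := by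
    have map_neg : (gaussianReal 0 1).map (fun x ↦ -x) = gaussianReal 0 1 := by
      simpa using gaussianReal_map_neg (μ := 0) (v := 1)
    rw [← map_neg, map_measureReal_apply measurable_neg measurableSet_Iic, map_neg]
    simp
  have hcover : 1 ≤ (gaussianReal 0 1).real (Set.Iic 0) + (gaussianReal 0 1).real (Set.Ici 0) := by
    rw [← probReal_univ (μ := gaussianReal 0 1), ← Set.Iic_union_Ici (a := (0 : ℝ))]
    exact measureReal_union_le _ _
  linarith

lemma one_div_six_le_gaussianPDFReal {x : ℝ} (hx : x ^ 2 ≤ 1) :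
    1 / 6 ≤ gaussianPDFReal 0 1 x := by
  have hexp : (1 / 2 : ℝ) ≤ Real.exp (-(x - 0) ^ 2 / (2 * (1 : ℝ≥0))) := by
    refine le_trans ?_ (Real.add_one_le_exp _)
    simp only [sub_zero, NNReal.coe_one, mul_one]
    linarith
  have hconst : (1 / 3 : ℝ) ≤ (√(2 * Real.pi * (1 : ℝ≥0)))⁻¹ := by
    rw [one_div]
    refine inv_anti₀ (Real.sqrt_pos.2 (by simp [Real.pi_pos])) ?_
    rw [Real.sqrt_le_left (by norm_num), NNReal.coe_one, mul_one]
    linarith [Real.pi_lt_d2]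
  calc (1 / 6 : ℝ) = 1 / 3 * (1 / 2) := by norm_num
    _ ≤ gaussianPDFReal 0 1 x := mul_le_mul hconst hexp (by norm_num) (by positivity)

lemma half_add_div_six_le_gaussianReal_Ici_neg {s : ℝ} (hs₀ : 0 ≤ s) (hs₁ : s ≤ 1) :
    1 / 2 + s / 6 ≤ (gaussianReal 0 1).real (Set.Ici (-s)) := by
  have hpdf (x : ℝ) (hx : x ∈ Set.Ico (-s) 0) :
      ENNReal.ofReal (1 / 6) ≤ gaussianPDF 0 1 x :=
    ENNReal.ofReal_le_ofReal (one_div_six_le_gaussianPDFReal (by nlinarith [hx.1, hx.2]))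
  have hIco : s / 6 ≤ (gaussianReal 0 1).real (Set.Ico (-s) 0) := by
    refine (ENNReal.ofReal_le_iff_le_toReal (measure_ne_top _ _)).1 ?_
    rw [gaussianReal_apply _ one_ne_zero]
    calc ENNReal.ofReal (s / 6) = ∫⁻ _ in Set.Ico (-s) 0, ENNReal.ofReal (1 / 6) := by
          rw [setLIntegral_const, Real.volume_Ico, ← ENNReal.ofReal_mul (by norm_num)]
          congr 1
          ring
      _ ≤ _ := setLIntegral_mono' measurableSet_Ico hpdf
  have hdisj : Disjoint (Set.Ico (-s) 0) (Set.Ici 0) :=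
    Set.disjoint_left.2 fun x hx hx' ↦ not_le.2 hx.2 hx'
  rw [← Set.Ico_union_Ici_eq_Ici (neg_nonpos.2 hs₀), measureReal_union hdisj measurableSet_Ici]
  linarith [half_le_gaussianReal_Ici_zero]

variable {d : ℕ}

lemma multivariateGaussian_one_eq_map (μ : EuclideanSpace ℝ (Fin d)) :
    multivariateGaussian μ 1 = (stdGaussian (EuclideanSpace ℝ (Fin d))).map (fun x ↦ μ + x) := by
  simp [multivariateGaussian]

lemma multivariateGaussian_real_halfspace (μ : EuclideanSpace ℝ (Fin d))
    {v : EuclideanSpace ℝ (Fin d)} (hv : ‖v‖ = 1) (s : ℝ) :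
    (multivariateGaussian μ 1).real {x | s ≤ inner ℝ v (x - μ)}
      = (gaussianReal 0 1).real (Set.Ici s) := by
  have hmap : (stdGaussian (EuclideanSpace ℝ (Fin d))).map (innerSL ℝ v) = gaussianReal 0 1 := by
    rw [IsGaussian.map_eq_gaussianReal, integral_strongDual_stdGaussian, variance_dual_stdGaussian]
    simp [hv]
  rw [multivariateGaussian_one_eq_map, map_measureReal_apply (by fun_prop)
    (isClosed_le continuous_const (by fun_prop)).measurableSet, ← hmap,
    map_measureReal_apply (by fun_prop) measurableSet_Ici]
  congr 1
  ext x
  simp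

end GaussianTail

section Depth

open Finset

variable {ι E : Type*} [Fintype ι] [NormedAddCommGroup E] [InnerProductSpace ℝ E]

-- A half-space bounded near `η` facing away from `μ` and one bounded near `μ` facing away from `η`
-- would be disjoint, and together hold more points than there are.
lemma norm_sub_le_of_mem_uniformlyDeep {μ η : E} {z : ι → E} {a b s r : ℝ} (hsr : 0 ≤ s + r)
    (hμ : z ∈ uniformlyDeep ι μ (-s) b) (hη : z ∈ uniformlyDeep ι η (-r) a)
    (hab : Fintype.card ι < a + b) : ‖η - μ‖ ≤ s + r := by
  classical
  by_contra! hfar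
  have hne : η - μ ≠ 0 := norm_pos_iff.1 (hsr.trans_lt hfar)
  let v : E := ‖η - μ‖⁻¹ • (η - μ)
  have hv : ‖v‖ = 1 := norm_smul_inv_norm (𝕜 := ℝ) hne
  have hvd : inner ℝ v (η - μ) = ‖η - μ‖ := by
    rw [real_inner_smul_left, real_inner_self_eq_norm_sq]
    field_simp
  have hdisj : Disjoint (halfspacePattern z η (-r) v) (halfspacePattern z μ (-s) (-v)) := by
    refine disjoint_left.2 fun i hi hi' ↦ ?_
    rw [mem_halfspacePattern] at hi hi'
    have hsplit : inner ℝ v (z i - μ) = inner ℝ v (z i - η) + ‖η - μ‖ := by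
      rw [← hvd, ← inner_add_right, sub_add_sub_cancel]
    rw [inner_neg_left] at hi'
    linarith
  have hcard : (#(halfspacePattern z η (-r) v) + #(halfspacePattern z μ (-s) (-v)) : ℝ)
      ≤ Fintype.card ι := by
    exact_mod_cast (card_union_of_disjoint hdisj).symm.trans_le (card_le_univ _)
  linarith [hη v hv, hμ (-v) (by rwa [norm_neg])]

lemma mem_uniformlyDeep_neg_of_norm_sub_le {μ η : E} {z : ι → E} {a r : ℝ}
    (hz : z ∈ uniformlyDeep ι μ 0 a) (h : ‖η - μ‖ ≤ r) : z ∈ uniformlyDeep ι η (-r) a := by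
  intro v hv
  refine (hz v hv).trans (Nat.cast_le.2 (card_le_card fun i hi ↦ ?_))
  rw [mem_halfspacePattern] at hi ⊢
  have hsplit : inner ℝ v (z i - μ) = inner ℝ v (z i - η) + inner ℝ v (η - μ) := by
    rw [← inner_add_right, sub_add_sub_cancel]
  have hcs : inner ℝ v (η - μ) ≤ ‖η - μ‖ := by simpa [hv] using real_inner_le_norm v (η - μ)
  linarith

lemma mem_uniformlyDeep_of_eqOn_compl {μ : E} {x z : ι → E} {s a b : ℝ} {B : Finset ι}
    (hx : x ∈ uniformlyDeep ι μ s a) (hB : ∀ i ∉ B, z i = x i) (hb : b + #B ≤ a) :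
    z ∈ uniformlyDeep ι μ s b := by
  classical
  intro v hv
  have hsub : halfspacePattern x μ s v ⊆ halfspacePattern z μ s v ∪ B := by
    intro i hi
    by_cases h : i ∈ B
    · exact mem_union_right _ h
    · exact mem_union_left _ (by simpa [hB i h] using hi)
  have hcard : (#(halfspacePattern x μ s v) : ℝ) ≤ #(halfspacePattern z μ s v) + #B := by
    exact_mod_cast (card_le_card hsub).trans (card_union_le _ _)
  linarith [hx v hv]

end Depth

section Threshold

open Finset

variable {n d : ℕ}

lemma card_subtype_eq_numBelow (lam : Fin n → I) (t : I) :
    Fintype.card {i // lam i ≤ t} = numBelow lam t := by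
  rw [numBelow, Fintype.card_subtype]

lemma nonempty_sphere_euclideanSpace (hd : 1 ≤ d) :
    Nonempty (Metric.sphere (0 : EuclideanSpace ℝ (Fin d)) 1) :=
  have : Nonempty (Fin d) := ⟨⟨0, hd⟩⟩
  (NormedSpace.sphere_nonempty.2 zero_le_one).to_subtype

lemma sum_thresholdWeights_eq (lam : Fin n → I) (t : I) (z : Fin n → EuclideanSpace ℝ (Fin d))
    (η v : EuclideanSpace ℝ (Fin d)) [∀ i, Decidable (0 ≤ inner ℝ v (z i - η))] :
    ∑ i, thresholdWeights lam t i * (if 0 ≤ inner ℝ v (z i - η) then 1 else 0)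
      = #(halfspacePattern (fun i : {i // lam i ≤ t} ↦ z i) η 0 v) / numBelow lam t := by
  have hcard : #(halfspacePattern (fun i : {i // lam i ≤ t} ↦ z i) η 0 v)
      = #{i | lam i ≤ t ∧ 0 ≤ inner ℝ v (z i - η)} := by
    rw [← card_map (Function.Embedding.subtype _)]
    congr 1
    ext i
    simp [and_comm]
  rw [hcard, card_eq_sum_ones, sum_filter, Nat.cast_sum, sum_div]
  refine sum_congr rfl fun i _ ↦ ?_
  by_cases hi : lam i ≤ t <;> by_cases hv : 0 ≤ inner ℝ v (z i - η) <;>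
    simp [thresholdWeights, hi, hv]

lemma div_le_tukeyDepth_iff (hd : 1 ≤ d) {lam : Fin n → I} {t : I} (hN : 0 < numBelow lam t)
    (z : Fin n → EuclideanSpace ℝ (Fin d)) (η : EuclideanSpace ℝ (Fin d)) (a : ℝ) :
    a / numBelow lam t ≤ tukeyDepth (thresholdWeights lam t) z η ↔
      (fun i : {i // lam i ≤ t} ↦ z i) ∈ uniformlyDeep _ η 0 a := by
  have := nonempty_sphere_euclideanSpace hd
  simp only [tukeyDepth, sum_thresholdWeights_eq]
  rw [le_ciInf_iff ⟨0, by rintro _ ⟨v, rfl⟩; positivity⟩]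
  simp only [div_le_div_iff_of_pos_right (Nat.cast_pos (α := ℝ).2 hN), Subtype.forall,
    mem_sphere_zero_iff_norm]
  rfl

-- The depth takes only finitely many values, namely total weights of subsets of the data.
lemma exists_isTukeyMedian (hd : 1 ≤ d) (w : Fin n → ℝ) (z : Fin n → EuclideanSpace ℝ (Fin d)) :
    ∃ η, IsTukeyMedian w z η := by
  classical
  have := nonempty_sphere_euclideanSpace hd
  let subsetWeights : Set ℝ := Set.range fun T : Finset (Fin n) ↦ ∑ i ∈ T, w i
  have hfin : subsetWeights.Finite := Set.finite_range _
  have depth_mem (η) : tukeyDepth w z η ∈ subsetWeights := by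
    have hsub : (Set.range fun v : Metric.sphere (0 : EuclideanSpace ℝ (Fin d)) 1 ↦
        ∑ i, w i * (if 0 ≤ inner ℝ (v : EuclideanSpace ℝ (Fin d)) (z i - η) then 1 else 0))
          ⊆ subsetWeights := by
      rintro _ ⟨v, rfl⟩
      exact ⟨({i | 0 ≤ inner ℝ (v : EuclideanSpace ℝ (Fin d)) (z i - η)} : Finset _),
        by simp [sum_filter]⟩
    convert! hsub ((Set.range_nonempty _).csInf_mem (hfin.subset hsub))
  obtain ⟨_, ⟨η, rfl⟩, hη⟩ := Set.exists_max_image _ id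
    (hfin.subset (Set.range_subset_iff.2 depth_mem)) (Set.range_nonempty (tukeyDepth w z))
  exact ⟨η, fun η' ↦ hη _ ⟨η', rfl⟩⟩

-- Lowering `s` to the largest rate not exceeding it, or to `0`, does not change `numBelow`.
lemma exists_forall_thresholdObjective_le (d : ℕ) (lam : Fin n → I) :
    ∃ t : I, ∀ s : I, thresholdObjective d lam t ≤ thresholdObjective d lam s := by
  let rates : Finset I := insert 0 (univ.image lam)
  obtain ⟨t, -, ht⟩ := exists_min_image rates (thresholdObjective d lam) (insert_nonempty _ _)
  refine ⟨t, fun s ↦ ?_⟩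
  obtain ⟨u, hu, hmax⟩ := exists_max_image (rates.filter (· ≤ s)) id ⟨0, by simp [rates]⟩
  obtain ⟨hu, hus⟩ := mem_filter.1 hu
  have hnum : numBelow lam u = numBelow lam s := by
    refine congrArg card (filter_congr fun i _ ↦ ⟨fun h ↦ h.trans hus, fun h ↦ ?_⟩)
    exact hmax (lam i) (by simp [rates, h])
  refine (ht u hu).trans ?_
  unfold thresholdObjective
  rw [hnum]
  gcongr
  exact u.2.1

lemma thresholdObjective_eq_ofReal (d : ℕ) {lam : Fin n → I} {t : I} (hN : 0 < numBelow lam t) :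
    thresholdObjective d lam t = ENNReal.ofReal ((t : ℝ) ^ 2 + d / numBelow lam t) := by
  rw [thresholdObjective, ENNReal.ofReal_add (by positivity) (by positivity),
    ENNReal.ofReal_div_of_pos (by exact_mod_cast hN), ENNReal.ofReal_natCast,
    ENNReal.ofReal_natCast]

lemma numBelow_pos_of_thresholdObjective_ne_top (hd : 1 ≤ d) {lam : Fin n → I} {t : I}
    (h : thresholdObjective d lam t ≠ ⊤) : 0 < numBelow lam t := by
  refine Nat.pos_of_ne_zero fun h₀ ↦ h ?_
  rw [thresholdObjective, h₀, Nat.cast_zero, ENNReal.div_zero (by simp; lia), add_top]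

lemma effectiveRate_eq_of_forall_le {lam : Fin n → I} {t : I}
    (ht : ∀ s : I, thresholdObjective d lam t ≤ thresholdObjective d lam s) :
    effectiveRate d lam = thresholdObjective d lam t :=
  le_antisymm (iInf_le _ t) (le_iInf ht)

lemma effectiveRate_eq_ofReal_of_forall_le (hd : 1 ≤ d) {lam : Fin n → I} {t : I} {c : ℝ≥0}
    (hc : effectiveRate d lam ≤ c)
    (ht : ∀ s : I, thresholdObjective d lam t ≤ thresholdObjective d lam s) :
    0 < numBelow lam t ∧ (t : ℝ) ^ 2 + d / numBelow lam t ≤ c ∧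
      effectiveRate d lam = ENNReal.ofReal ((t : ℝ) ^ 2 + d / numBelow lam t) := by
  have hrate := effectiveRate_eq_of_forall_le ht
  have hN := numBelow_pos_of_thresholdObjective_ne_top hd
    (ne_top_of_le_ne_top ENNReal.coe_ne_top (hrate.symm.trans_le hc))
  rw [thresholdObjective_eq_ofReal d hN] at hrate
  exact ⟨hN, Real.toNNReal_le_iff_le_coe.1 (ENNReal.coe_le_coe.1 (hrate.symm.trans_le hc)), hrate⟩

end Threshold

section Contamination

variable {n : ℕ} {ι E : Type*} [MeasurableSpace E]

open Finset

lemma pi_bernoulliMeasure_le_card_le {κ : Type*} [Fintype ι] [Fintype κ] (lam : ι → I) (f : κ → ι)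
    {e : ℝ} (he : 0 < e) :
    (Measure.pi fun i ↦ bernoulliMeasure true false (lam i)) {b | e ≤ #{k | b (f k) = true}}
      ≤ ENNReal.ofReal ((∑ k, (lam (f k) : ℝ)) / e) := by
  set m := Measure.pi fun i ↦ bernoulliMeasure true false (lam i)
  let flag (c : Bool) : ℝ := if c = true then 1 else 0
  have hmean : ∫ b, ∑ k, flag (b (f k)) ∂m = ∑ k, (lam (f k) : ℝ) := by
    rw [integral_finsetSum _ fun k _ ↦ Integrable.of_finite]
    refine sum_congr rfl fun k _ ↦ ?_
    rw [integral_comp_eval (μ := fun i ↦ bernoulliMeasure true false (lam i)) (i := f k) (f := flag)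
      (measurable_of_countable flag).aestronglyMeasurable, integral_bernoulliMeasure]
    simp [flag]
  have hmarkov := mul_meas_ge_le_integral_of_nonneg (μ := m) (f := fun b ↦ ∑ k, flag (b (f k)))
    (ae_of_all _ fun b ↦ sum_nonneg fun k _ ↦ by positivity) Integrable.of_finite e
  have hcount (b : ι → Bool) : ∑ k, flag (b (f k)) = #{k | b (f k) = true} := by simp [flag]
  rw [ENNReal.le_ofReal_iff_toReal_le (measure_ne_top _ _)
    (div_nonneg (sum_nonneg fun k _ ↦ (lam (f k)).2.1) he.le), le_div_iff₀' he, ← hmean]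
  simp only [hcount] at hmarkov ⊢
  exact hmarkov

lemma measurePreserving_pi_subtype [Fintype ι] {X : ι → Type*} [∀ i, MeasurableSpace (X i)]
    (μ : ∀ i, Measure (X i)) [∀ i, IsProbabilityMeasure (μ i)] (p : ι → Prop) [DecidablePred p] :
    MeasurePreserving (fun (x : ∀ i, X i) (i : {i // p i}) ↦ x i)
      (Measure.pi μ) (Measure.pi fun i ↦ μ i) :=
  (measurePreserving_fst (μ := Measure.pi fun i : {i // p i} ↦ μ i)
    (ν := Measure.pi fun i : {i // ¬ p i} ↦ μ i)).comp (measurePreserving_piEquivPiSubtypeProd μ p)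

/-- The observed sample, given a clean sample, its contamination flag and an outlier; this is the
function of one index used in `contaminatedLaws`. -/
def observedSample {E : Type*} (q : (E × Bool) × E) : E := if q.1.2 = true then q.2 else q.1.1

lemma measurable_observedSample : Measurable (observedSample (E := E)) :=
  Measurable.ite (measurable_snd.comp measurable_fst (measurableSet_singleton true)) measurable_snd
    (measurable_fst.comp measurable_fst)

lemma measurable_pi_observedSample :
    Measurable fun (q : ((ι → E) × (ι → Bool)) × (ι → E)) i ↦
      observedSample ((q.1.1 i, q.1.2 i), q.2 i) :=
  measurable_pi_lambda _ fun i ↦ measurable_observedSample.comp (by fun_prop)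

lemma measure_compl_le_of_mem_contaminatedLaws {lam : Fin n → I} {P : Measure E}
    [IsProbabilityMeasure P] {ν : Measure (Fin n → E)} (hν : ν ∈ contaminatedLaws lam P)
    {A G : Set (Fin n → E)} {W : Set (Fin n → Bool)} (hA : MeasurableSet A) (hG : MeasurableSet G)
    (h : ∀ x ∈ A, ∀ b ∈ W, ∀ y : Fin n → E, (fun i ↦ if b i = true then y i else x i) ∈ G) :
    ν Gᶜ ≤ (Measure.pi fun _ ↦ P) Aᶜ
      + (Measure.pi fun i ↦ bernoulliMeasure true false (lam i)) Wᶜ := by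
  obtain ⟨κ, _, rfl⟩ := hν
  set mX := Measure.pi fun _ : Fin n ↦ P
  set mB := Measure.pi fun i ↦ bernoulliMeasure true false (lam i)
  let bad : Set ((Fin n → E) × (Fin n → Bool)) := Prod.fst ⁻¹' Aᶜ ∪ Prod.snd ⁻¹' Wᶜ
  have hbad : MeasurableSet bad := (measurable_fst hA.compl).union (measurable_snd .of_discrete)
  have hsub : (fun (q : ((Fin n → E) × (Fin n → Bool)) × (Fin n → E)) i ↦
      if q.1.2 i = true then q.2 i else q.1.1 i) ⁻¹' Gᶜ ⊆ Prod.fst ⁻¹' bad := by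
    rintro ⟨⟨x, b⟩, y⟩ hq
    by_contra! hgood
    rw [Set.mem_preimage, Set.mem_union, not_or] at hgood
    exact hq (h x (not_not.1 hgood.1) b (not_not.1 hgood.2) y)
  refine (Measure.map_apply measurable_pi_observedSample hG.compl).trans_le ?_
  calc ((mX.prod mB) ⊗ₘ κ) _ ≤ ((mX.prod mB) ⊗ₘ κ) (Prod.fst ⁻¹' bad) := measure_mono hsub
    _ = (mX.prod mB) bad := by
        rw [← Measure.map_apply measurable_fst hbad, ← Measure.fst, Measure.fst_compProd]
    _ ≤ (mX.prod mB) (Prod.fst ⁻¹' Aᶜ) + (mX.prod mB) (Prod.snd ⁻¹' Wᶜ) := measure_union_le _ _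
    _ = mX Aᶜ + mB Wᶜ := by
        rw [measurePreserving_fst.measure_preimage hA.compl.nullMeasurableSet,
          measurePreserving_snd.measure_preimage (MeasurableSet.of_discrete).nullMeasurableSet]

lemma map_observedSample (P Q : Measure E) [IsProbabilityMeasure P] [IsProbabilityMeasure Q]
    (p : I) :
    ((P.prod (bernoulliMeasure true false p)).prod Q).map observedSample
      = unitInterval.toNNReal p • Q + unitInterval.toNNReal (unitInterval.symm p) • P := by
  have map_flag (b : Bool) : ((P.map fun x ↦ (x, b)).prod Q).map observedSample
      = (P.prod Q).map fun q ↦ observedSample ((q.1, b), q.2) := by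
    have hprod : (P.map fun x ↦ (x, b)).prod Q = (P.prod Q).map (Prod.map (fun x ↦ (x, b)) id) := by
      rw [← Measure.map_prod_map _ _ (by fun_prop) measurable_id, Measure.map_id]
    rw [hprod, Measure.map_map measurable_observedSample (by fun_prop)]
    rfl
  have map_true : (P.prod Q).map (fun q ↦ observedSample ((q.1, true), q.2)) = Q :=
    measurePreserving_snd.map_eq
  have map_false : (P.prod Q).map (fun q ↦ observedSample ((q.1, false), q.2)) = P :=
    measurePreserving_fst.map_eq
  rw [bernoulliMeasure_def, Measure.prod_add, Measure.prod_smul_right, Measure.prod_smul_right,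
    Measure.prod_dirac, Measure.prod_dirac, Measure.add_prod, Measure.prod_smul_left,
    Measure.prod_smul_left, Measure.map_add _ _ measurable_observedSample, Measure.map_smul,
    Measure.map_smul, map_flag, map_flag, map_true, map_false]

-- The adversary draws independent outliers.
lemma pi_mem_contaminatedLaws {lam : Fin n → I} {P : Measure E} [IsProbabilityMeasure P]
    {Q : Fin n → Measure E} [∀ i, IsProbabilityMeasure (Q i)] {L : Fin n → Measure E}
    (hL : ∀ i, unitInterval.toNNReal (lam i) • Q i +
      unitInterval.toNNReal (unitInterval.symm (lam i)) • P = L i) :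
    Measure.pi L ∈ contaminatedLaws lam P := by
  refine ⟨Kernel.const _ (Measure.pi Q), inferInstance, ?_⟩
  let B (i : Fin n) : Measure Bool := bernoulliMeasure true false (lam i)
  have hcurry := ((measurePreserving_arrowProdEquivProdArrow E Bool (Fin n) (fun _ ↦ P) B).prod
    (MeasurePreserving.id (Measure.pi Q))).comp
      (measurePreserving_arrowProdEquivProdArrow (E × Bool) E (Fin n) (fun i ↦ P.prod (B i)) Q)
  have hmap (i : Fin n) : ((P.prod (B i)).prod (Q i)).map observedSample = L i := by
    rw [← hL i, ← map_observedSample]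
  have hpi := Measure.pi_map_pi (μ := fun i ↦ (P.prod (B i)).prod (Q i))
    (f := fun _ ↦ observedSample)
    (hμ := fun i ↦ by
      have := Measure.isProbabilityMeasure_map (μ := (P.prod (B i)).prod (Q i))
        measurable_observedSample.aemeasurable
      infer_instance)
    (fun _ ↦ measurable_observedSample.aemeasurable)
  simp only [hmap] at hpi
  rw [Measure.compProd_const, ← hcurry.map_eq, ← hpi]
  exact (Measure.map_map measurable_pi_observedSample hcurry.measurable).symm

lemma exists_mixture_eq {P Q : Measure E} [IsProbabilityMeasure P] [IsProbabilityMeasure Q]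
    {p : I} (hp : p ≠ 0) (hle : unitInterval.toNNReal (unitInterval.symm p) • P ≤ Q) :
    ∃ Q' : Measure E, IsProbabilityMeasure Q' ∧
      unitInterval.toNNReal p • Q' + unitInterval.toNNReal (unitInterval.symm p) • P = Q := by
  set c := unitInterval.toNNReal p with hc
  set c' := unitInterval.toNNReal (unitInterval.symm p)
  have hsum : c + c' = 1 := unitInterval.toNNReal_add_toNNReal_symm p
  have hc₀ : c ≠ 0 := fun h ↦ hp <| by
    ext
    rw [← unitInterval.coe_toNNReal, ← hc, h]
    simp
  have huniv : (Q - c' • P) Set.univ = c := by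
    rw [Measure.sub_apply MeasurableSet.univ hle, Measure.smul_apply, measure_univ, measure_univ,
      ENNReal.smul_def, smul_eq_mul, mul_one, ← ENNReal.coe_one, ← hsum, ENNReal.coe_add]
    exact ENNReal.add_sub_cancel_right ENNReal.coe_ne_top
  refine ⟨c⁻¹ • (Q - c' • P), ⟨?_⟩, ?_⟩
  · rw [Measure.smul_apply, huniv, ENNReal.smul_def, smul_eq_mul, ← ENNReal.coe_mul,
      inv_mul_cancel₀ hc₀, ENNReal.coe_one]
  · rw [smul_smul, mul_inv_cancel₀ hc₀, one_smul, Measure.sub_add_cancel_of_le hle]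

end Contamination

section Minimax

variable {n d : ℕ} {lam : Fin n → I} {𝒟 : Set (Measure (EuclideanSpace ℝ (Fin d)))} {δ r : ℝ≥0∞}

lemma minimaxPAC_le {M : (Fin n → EuclideanSpace ℝ (Fin d)) → EuclideanSpace ℝ (Fin d)}
    (hM : Measurable M)
    (h : (⨆ P ∈ 𝒟, ⨆ ν ∈ contaminatedLaws lam P, ν {z | r ≤ ‖M z - ∫ x, x ∂P‖ₑ ^ 2}) ≤ δ) :
    minimaxPAC lam 𝒟 δ ≤ r := by
  refine sInf_le ?_
  rw [Set.mem_ofPred_eq]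
  exact (iInf₂_le M hM).trans h

lemma le_minimaxPAC {δ' : ℝ≥0∞} (hδ : δ < δ')
    (h : ∀ M : (Fin n → EuclideanSpace ℝ (Fin d)) → EuclideanSpace ℝ (Fin d), Measurable M →
      ∃ P ∈ 𝒟, ∃ ν ∈ contaminatedLaws lam P, δ' ≤ ν {z | r ≤ ‖M z - ∫ x, x ∂P‖ₑ ^ 2}) :
    r ≤ minimaxPAC lam 𝒟 δ := by
  refine le_sInf fun t ht ↦ ?_
  by_contra! htr
  refine (hδ.trans_le (le_iInf₂ fun M hM ↦ ?_)).not_ge ht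
  obtain ⟨P, hP, ν, hν, hle⟩ := h M hM
  calc δ' ≤ ν {z | t ≤ ‖M z - ∫ x, x ∂P‖ₑ ^ 2} :=
        hle.trans (measure_mono fun z hz ↦ htr.le.trans hz)
    _ ≤ ⨆ ν ∈ contaminatedLaws lam P, ν {z | t ≤ ‖M z - ∫ x, x ∂P‖ₑ ^ 2} :=
        le_iSup₂ (f := fun ν (_ : ν ∈ contaminatedLaws lam P) ↦
          ν {z | t ≤ ‖M z - ∫ x, x ∂P‖ₑ ^ 2}) ν hν
    _ ≤ _ := le_iSup₂ (f := fun P (_ : P ∈ 𝒟) ↦ ⨆ ν ∈ contaminatedLaws lam P,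
        ν {z | t ≤ ‖M z - ∫ x, x ∂P‖ₑ ^ 2}) P hP

end Minimax

section GoodDatasets

open Finset

variable {n : ℕ} {E : Type*} [NormedAddCommGroup E] [InnerProductSpace ℝ E]

/-- The event of the upper bound: among the samples with contamination rate at most `t`, every
half-space through `μ` holds at least `a` points, and every half-space containing the ball of
radius `s` around `μ` holds at least `b` points. -/
def goodDatasets (lam : Fin n → I) (t : I) (μ : E) (s a b : ℝ) : Set (Fin n → E) :=
  (fun z (i : {i // lam i ≤ t}) ↦ z i) ⁻¹' (uniformlyDeep _ μ 0 a ∩ uniformlyDeep _ μ (-s) b)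

lemma measurableSet_goodDatasets [SecondCountableTopology E] [MeasurableSpace E]
    [OpensMeasurableSpace E] (lam : Fin n → I) (t : I) (μ : E) (s a b : ℝ) :
    MeasurableSet (goodDatasets lam t μ s a b) :=
  (((isClosed_uniformlyDeep _ _ _).inter (isClosed_uniformlyDeep _ _ _)).preimage
    (by fun_prop)).measurableSet

lemma pi_bernoulliMeasure_le_card_below_le (lam : Fin n → I) (t : I) {e : ℝ} (he : 0 < e) :
    (Measure.pi fun i ↦ bernoulliMeasure true false (lam i))
        {b | e ≤ #{i : {i // lam i ≤ t} | b i = true}}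
      ≤ ENNReal.ofReal (numBelow lam t * t / e) := by
  refine (pi_bernoulliMeasure_le_card_le lam _ he).trans (ENNReal.ofReal_le_ofReal ?_)
  gcongr
  rw [← card_subtype_eq_numBelow, ← nsmul_eq_mul]
  exact sum_le_card_nsmul _ _ _ fun i _ ↦ i.2

lemma measure_compl_goodDatasets_le [Nontrivial E] [FiniteDimensional ℝ E] [MeasurableSpace E]
    [BorelSpace E] {P : Measure E} [IsProbabilityMeasure P] {lam : Fin n → I} {t : I} {μ : E}
    {s p q : ℝ} (hp : ∀ v : E, ‖v‖ = 1 → p ≤ P.real {x | 0 ≤ inner ℝ v (x - μ)})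
    (hq : ∀ v : E, ‖v‖ = 1 → q ≤ P.real {x | -s ≤ inner ℝ v (x - μ)}) {e : ℝ} (he : 0 < e)
    {ν : Measure (Fin n → E)} (hν : ν ∈ contaminatedLaws lam P) :
    ν (goodDatasets lam t μ s (numBelow lam t * p - 2 * e) (numBelow lam t * q - 2 * e))ᶜ
      ≤ 2 * ENNReal.ofReal (46 * √((Module.finrank ℝ E + 1 : ℕ) * numBelow lam t) / e)
        + ENNReal.ofReal (numBelow lam t * t / e) := by
  have hproper : ProperSpace E := FiniteDimensional.proper_real E
  let deep (s p : ℝ) : Set (Fin n → E) := (fun z (i : {i // lam i ≤ t}) ↦ z i) ⁻¹'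
    uniformlyDeep _ μ s (numBelow lam t * p - e)
  have hdeep (s p : ℝ) : MeasurableSet (deep s p) :=
    ((isClosed_uniformlyDeep _ _ _).preimage (by fun_prop)).measurableSet
  have measure_deep (s p : ℝ) (h : ∀ v : E, ‖v‖ = 1 → p ≤ P.real {x | s ≤ inner ℝ v (x - μ)}) :
      (Measure.pi fun _ ↦ P) (deep s p)ᶜ
        ≤ ENNReal.ofReal (46 * √((Module.finrank ℝ E + 1 : ℕ) * numBelow lam t) / e) := by
    rw [← Set.preimage_compl, (measurePreserving_pi_subtype (fun _ : Fin n ↦ P)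
      fun i ↦ lam i ≤ t).measure_preimage
        (isClosed_uniformlyDeep _ _ _).measurableSet.compl.nullMeasurableSet,
      ← card_subtype_eq_numBelow]
    exact measure_compl_uniformlyDeep_le P h he
  refine (measure_compl_le_of_mem_contaminatedLaws hν (A := deep 0 p ∩ deep (-s) q)
    (W := {b | e ≤ #{i : {i // lam i ≤ t} | b i = true}}ᶜ) ((hdeep _ _).inter (hdeep _ _))
    (measurableSet_goodDatasets ..) fun x hx b hb y ↦ ?_).trans (add_le_add ?_ ?_)
  · have hfew : #{i : {i // lam i ≤ t} | b i = true} < e := not_le.1 hb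
    have hclean (i : {i // lam i ≤ t}) (hi : i ∉ ({i | b i = true} : Finset {i // lam i ≤ t})) :
        (if b i = true then y i else x i) = x i := if_neg (by simpa using hi)
    exact ⟨mem_uniformlyDeep_of_eqOn_compl hx.1 hclean (by linarith),
      mem_uniformlyDeep_of_eqOn_compl hx.2 hclean (by linarith)⟩
  · rw [Set.compl_inter, two_mul]
    exact (measure_union_le _ _).trans (add_le_add (measure_deep 0 p hp) (measure_deep (-s) q hq))
  · rw [compl_compl]
    exact pi_bernoulliMeasure_le_card_below_le lam t he

-- A rule picking the first point of a dense sequence with large relaxed depth is measurable.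
lemma exists_measurable_norm_sub_le [SecondCountableTopology E] [MeasurableSpace E]
    [OpensMeasurableSpace E] (lam : Fin n → I) (t : I) {s a b : ℝ} (hs : 0 < s)
    (hab : numBelow lam t < a + b) :
    ∃ M : (Fin n → E) → E, Measurable M ∧
      ∀ μ, ∀ z ∈ goodDatasets lam t μ s a b, ‖M z - μ‖ ≤ s + s := by
  classical
  let q : ℕ → E := TopologicalSpace.denseSeq E
  let deepAt (k : ℕ) : Set (Fin n → E) :=
    (fun z (i : {i // lam i ≤ t}) ↦ z i) ⁻¹' uniformlyDeep _ (q k) (-s) a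
  have hdeepAt (k : ℕ) : MeasurableSet (deepAt k) :=
    ((isClosed_uniformlyDeep _ _ _).preimage (by fun_prop)).measurableSet
  have hex (z : Fin n → E) : ∃ k, z ∈ deepAt k ∪ ⋂ j, (deepAt j)ᶜ := by
    by_cases h : ∃ k, z ∈ deepAt k
    · exact h.imp fun k hk ↦ Or.inl hk
    · exact ⟨0, Or.inr (Set.mem_iInter.2 (not_exists.1 h))⟩
  refine ⟨fun z ↦ q (Nat.find (hex z)), (measurable_from_top (f := q)).comp (measurable_find hex
    fun k ↦ (hdeepAt k).union (.iInter fun j ↦ (hdeepAt j).compl)), fun μ z hz ↦ ?_⟩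
  obtain ⟨k, hk⟩ := (TopologicalSpace.denseRange_denseSeq E).exists_dist_lt μ hs
  have hzk : z ∈ deepAt k := mem_uniformlyDeep_neg_of_norm_sub_le hz.1
    (by rw [← dist_eq_norm, dist_comm]; exact hk.le)
  have hfind : z ∈ deepAt (Nat.find (hex z)) :=
    (Nat.find_spec (hex z)).resolve_right fun h ↦ Set.mem_iInter.1 h k hzk
  exact norm_sub_le_of_mem_uniformlyDeep (by positivity) hz.2 hfind
    (by rwa [card_subtype_eq_numBelow])

end GoodDatasets

section UpperBound

variable {n d : ℕ} {lam : Fin n → I} {t : I}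

lemma norm_sub_le_of_isTukeyMedian (hd : 1 ≤ d) (hN : 0 < numBelow lam t) {s a b : ℝ} (hs : 0 ≤ s)
    (hab : numBelow lam t < a + b) {μ η : EuclideanSpace ℝ (Fin d)}
    {z : Fin n → EuclideanSpace ℝ (Fin d)} (hz : z ∈ goodDatasets lam t μ s a b)
    (hη : IsTukeyMedian (thresholdWeights lam t) z η) : ‖η - μ‖ ≤ s := by
  have hdeep : (fun i : {i // lam i ≤ t} ↦ z i) ∈ uniformlyDeep _ η (-0) a := by
    rw [neg_zero]
    exact (div_le_tukeyDepth_iff hd hN z η a).1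
      (((div_le_tukeyDepth_iff hd hN z μ a).2 hz.1).trans (hη μ))
  simpa using norm_sub_le_of_mem_uniformlyDeep (by simpa using hs) hz.2 hdeep
    (by rwa [card_subtype_eq_numBelow])

lemma measure_compl_goodDatasets_multivariateGaussian_le (hd : 1 ≤ d) (hN : 0 < numBelow lam t)
    {ρ : ℝ} (hρ : 0 < ρ) (hρ₁ : 25000 * ρ ≤ 1) (htρ : t ≤ ρ) (hdρ : d ≤ ρ ^ 2 * numBelow lam t)
    {μ : EuclideanSpace ℝ (Fin d)} {ν : Measure (Fin n → EuclideanSpace ℝ (Fin d))}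
    (hν : ν ∈ contaminatedLaws lam (multivariateGaussian μ 1)) :
    ν (goodDatasets lam t μ (25000 * ρ)
      (numBelow lam t * (1 / 2) - 2 * (1000 * ρ * numBelow lam t))
      (numBelow lam t * (1 / 2 + 25000 * ρ / 6) - 2 * (1000 * ρ * numBelow lam t)))ᶜ ≤ 1 / 5 := by
  have : Nonempty (Fin d) := ⟨⟨0, hd⟩⟩
  have hd' : (1 : ℝ) ≤ d := by exact_mod_cast hd
  have hN' : (0 : ℝ) < numBelow lam t := by exact_mod_cast hN
  have he : 0 < 1000 * ρ * numBelow lam t := by positivity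
  have deviation_le : 46 * √((Module.finrank ℝ (EuclideanSpace ℝ (Fin d)) + 1 : ℕ)
      * numBelow lam t) / (1000 * ρ * numBelow lam t) ≤ 1 / 15 := by
    have hsqrt : √((d + 1 : ℕ) * numBelow lam t) ≤ 17 / 12 * (ρ * numBelow lam t) := by
      rw [Real.sqrt_le_left (by positivity)]
      push_cast
      nlinarith
    rw [finrank_euclideanSpace_fin, div_le_iff₀ he]
    linarith [mul_pos hρ hN']
  have contamination_le : (numBelow lam t * t / (1000 * ρ * numBelow lam t) : ℝ) ≤ 1 / 15 := by
    rw [div_le_iff₀ he]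
    nlinarith
  calc _ ≤ _ := measure_compl_goodDatasets_le
        (fun v hv ↦ (multivariateGaussian_real_halfspace μ hv 0).symm ▸
          half_le_gaussianReal_Ici_zero)
        (fun v hv ↦ (multivariateGaussian_real_halfspace μ hv _).symm ▸
          half_add_div_six_le_gaussianReal_Ici_neg (by positivity) hρ₁) he hν
    _ ≤ 2 * ENNReal.ofReal (1 / 15) + ENNReal.ofReal (1 / 15) := by gcongr
    _ = ENNReal.ofReal (1 / 5) := by
        rw [← ENNReal.ofReal_ofNat, ← ENNReal.ofReal_mul (by norm_num),
          ← ENNReal.ofReal_add (by norm_num) (by norm_num)]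
        norm_num
    _ = 1 / 5 := by rw [ENNReal.ofReal_div_of_pos (by norm_num)]; simp

lemma exists_radius_goodDatasets (hd : 1 ≤ d) (hN : 0 < numBelow lam t)
    (hF : (t : ℝ) ^ 2 + d / numBelow lam t ≤ 1 / 10 ^ 10) :
    ∃ s a b : ℝ, 0 < s ∧ (s + s) ^ 2 < 10 ^ 10 * ((t : ℝ) ^ 2 + d / numBelow lam t) ∧
      numBelow lam t < a + b ∧ ∀ μ : EuclideanSpace ℝ (Fin d),
        ∀ ν ∈ contaminatedLaws lam (multivariateGaussian μ 1),
          ν (goodDatasets lam t μ s a b)ᶜ ≤ 1 / 5 := by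
  have : (0 : ℝ) < d := by exact_mod_cast hd
  have hN' : (0 : ℝ) < numBelow lam t := by exact_mod_cast hN
  have ht₀ : (0 : ℝ) ≤ t := t.2.1
  set N : ℝ := (numBelow lam t : ℝ)
  set ρ : ℝ := t + √(d / N)
  have hsqrt : 0 < √(d / N) := Real.sqrt_pos.2 (by positivity)
  have hsq : √(d / N) ^ 2 = d / N := Real.sq_sqrt (by positivity)
  have hρ : 0 < ρ := by positivity
  have hρ_sq : ρ ^ 2 ≤ 2 * ((t : ℝ) ^ 2 + d / N) := by
    rw [← hsq]
    exact add_sq_le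
  have hρ₁ : 25000 * ρ ≤ 1 := by
    refine (sq_le_one_iff₀ (by positivity)).1 ?_
    linarith [mul_pow 25000 ρ 2]
  have hdρ : d ≤ ρ ^ 2 * N := by
    rw [← div_le_iff₀ hN', ← hsq]
    exact pow_le_pow_left₀ hsqrt.le (le_add_of_nonneg_left ht₀) 2
  refine ⟨25000 * ρ, _, _, by positivity, ?_, ?_, fun μ ν hν ↦
    measure_compl_goodDatasets_multivariateGaussian_le hd hN hρ hρ₁
      (le_add_of_nonneg_right hsqrt.le) hdρ hν⟩
  · nlinarith [sq_pos_of_pos hρ]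
  · linarith [mul_pos hρ hN', show N * (25000 * ρ / 6) = 25000 / 6 * (ρ * N) by ring]

lemma iSup_contaminatedLaws_idGaussians_le {δ r : ℝ≥0∞}
    {M : (Fin n → EuclideanSpace ℝ (Fin d)) → EuclideanSpace ℝ (Fin d)}
    {G : EuclideanSpace ℝ (Fin d) → Set (Fin n → EuclideanSpace ℝ (Fin d))}
    (hG : ∀ μ, ∀ ν ∈ contaminatedLaws lam (multivariateGaussian μ 1), ν (G μ)ᶜ ≤ δ)
    (hM : ∀ μ, ∀ z ∈ G μ, ‖M z - μ‖ₑ ^ 2 < r) :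
    (⨆ P ∈ idGaussians d, ⨆ ν ∈ contaminatedLaws lam P,
      ν {z | r ≤ ‖M z - ∫ x, x ∂P‖ₑ ^ 2}) ≤ δ := by
  refine iSup₂_le fun P ⟨μ, hP⟩ ↦ iSup₂_le fun ν hν ↦ ?_
  subst hP
  refine (measure_mono fun z hz hzG ↦ ?_).trans (hG μ ν hν)
  rw [integral_id_multivariateGaussian] at hz
  exact (hM μ z hzG).not_ge hz

lemma enorm_sq_lt_of_norm_le {E : Type*} [NormedAddCommGroup E] {x : E} {r A B : ℝ} (hA : 0 ≤ A)
    (hx : ‖x‖ ≤ r) (hr : r ^ 2 < A * B) :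
    ‖x‖ₑ ^ 2 < ENNReal.ofReal A * ENNReal.ofReal B := by
  rw [← ofReal_norm, ← ENNReal.ofReal_pow (norm_nonneg _), ← ENNReal.ofReal_mul hA]
  exact (ENNReal.ofReal_lt_ofReal_iff_of_nonneg (by positivity)).2
    ((pow_le_pow_left₀ (norm_nonneg _) hx 2).trans_lt hr)

lemma minimaxPAC_idGaussians_le (hd : 1 ≤ d) (hN : 0 < numBelow lam t)
    (hF : (t : ℝ) ^ 2 + d / numBelow lam t ≤ 1 / 10 ^ 10) :
    minimaxPAC lam (idGaussians d) (1 / 5)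
      ≤ ENNReal.ofReal (10 ^ 10) * ENNReal.ofReal ((t : ℝ) ^ 2 + d / numBelow lam t) := by
  obtain ⟨s, a, b, hs, hsF, hab, hgood⟩ := exists_radius_goodDatasets hd hN hF
  obtain ⟨M, hM, hMgood⟩ :=
    exists_measurable_norm_sub_le (E := EuclideanSpace ℝ (Fin d)) lam t hs hab
  exact minimaxPAC_le hM (iSup_contaminatedLaws_idGaussians_le hgood fun μ z hz ↦
    enorm_sq_lt_of_norm_le (by norm_num) (hMgood μ z hz) hsF)

lemma iSup_contaminatedLaws_isTukeyMedian_le (hd : 1 ≤ d) (hN : 0 < numBelow lam t)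
    (hF : (t : ℝ) ^ 2 + d / numBelow lam t ≤ 1 / 10 ^ 10)
    {M : (Fin n → EuclideanSpace ℝ (Fin d)) → EuclideanSpace ℝ (Fin d)}
    (hM : ∀ z, IsTukeyMedian (thresholdWeights lam t) z (M z)) :
    (⨆ P ∈ idGaussians d, ⨆ ν ∈ contaminatedLaws lam P,
      ν {z | ENNReal.ofReal (10 ^ 10) * ENNReal.ofReal ((t : ℝ) ^ 2 + d / numBelow lam t)
        ≤ ‖M z - ∫ x, x ∂P‖ₑ ^ 2}) ≤ 1 / 5 := by
  obtain ⟨s, a, b, hs, hsF, hab, hgood⟩ := exists_radius_goodDatasets hd hN hF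
  refine iSup_contaminatedLaws_idGaussians_le hgood fun μ z hz ↦
    enorm_sq_lt_of_norm_le (by norm_num) ?_ hsF
  exact (norm_sub_le_of_isTukeyMedian hd hN hs.le hab hz (hM z)).trans (by linarith)

end UpperBound

section ProductDensity

open Finset

variable {ι : Type*} [Fintype ι] {X : ι → Type*} [∀ i, MeasurableSpace (X i)]

lemma lintegral_pi_prod (μ : ∀ i, Measure (X i)) [∀ i, IsProbabilityMeasure (μ i)] (s : Finset ι)
    {f : ∀ i, X i → ℝ≥0∞} (hf : ∀ i, Measurable (f i)) :
    ∫⁻ x, ∏ i ∈ s, f i (x i) ∂Measure.pi μ = ∏ i ∈ s, ∫⁻ y, f i y ∂μ i := by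
  rw [lintegral_prod_eq_prod_lintegral_of_indepFun s (fun i (x : ∀ i, X i) ↦ f i (x i))
    (iIndepFun_pi fun i ↦ (hf i).aemeasurable) fun i ↦ (hf i).comp (measurable_pi_apply i)]
  exact prod_congr rfl fun i _ ↦ (measurePreserving_eval μ i).lintegral_comp (hf i)

lemma pi_withDensity {μ ν : ∀ i, Measure (X i)} [∀ i, IsProbabilityMeasure (μ i)]
    [∀ i, SigmaFinite (ν i)] {f : ∀ i, X i → ℝ≥0∞} (hf : ∀ i, Measurable (f i))
    (hν : ∀ i, ν i = (μ i).withDensity (f i)) :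
    Measure.pi ν = (Measure.pi μ).withDensity fun x ↦ ∏ i, f i (x i) := by
  classical
  refine Measure.pi_eq fun s hs ↦ ?_
  have indicator_prod (x : ∀ i, X i) : (Set.univ.pi s).indicator (fun x ↦ ∏ i, f i (x i)) x
      = ∏ i, (s i).indicator (f i) (x i) := by
    simp only [Set.indicator_apply, prod_ite_zero, Set.mem_univ_pi, mem_univ, true_imp_iff]
  rw [withDensity_apply _ (MeasurableSet.univ_pi hs),
    ← lintegral_indicator (MeasurableSet.univ_pi hs)]
  simp only [indicator_prod]
  rw [lintegral_pi_prod μ univ fun i ↦ (hf i).indicator (hs i)]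
  refine prod_congr rfl fun i _ ↦ ?_
  rw [lintegral_indicator (hs i), hν i, withDensity_apply _ (hs i)]

end ProductDensity

section LikelihoodRatio

variable {X : Type*}

lemma two_mul_indicator_add_le (A : Set X) (θ : ℝ≥0) (g : X → ℝ≥0∞) (x : X) :
    A.indicator (fun _ ↦ 2 * (θ : ℝ≥0∞)) x + 2 * g x
      ≤ A.indicator (fun x ↦ 2 * θ * g x) x + (θ ^ 2 + 1 + g x ^ 2) := by
  obtain hg | hg := eq_or_ne (g x) ⊤
  · simp [hg]
  lift g x to ℝ≥0 using hg with r hr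
  by_cases hx : x ∈ A
  · rw [Set.indicator_of_mem hx, Set.indicator_of_mem hx, ← hr]
    norm_cast
    rw [← NNReal.coe_le_coe]
    push_cast
    linarith [sq_nonneg ((θ : ℝ) - 1 + r)]
  · rw [Set.indicator_of_notMem hx, Set.indicator_of_notMem hx]
    norm_cast
    rw [← NNReal.coe_le_coe]
    push_cast
    linarith [sq_nonneg (1 - (r : ℝ)), sq_nonneg (θ : ℝ)]

variable [MeasurableSpace X]

lemma lintegral_eq_one_of_eq_withDensity {ν ν' : Measure X} [IsProbabilityMeasure ν']
    {g : X → ℝ≥0∞} (hν : ν' = ν.withDensity g) : ∫⁻ x, g x ∂ν = 1 := by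
  rw [← setLIntegral_univ, ← withDensity_apply _ MeasurableSet.univ, ← hν, measure_univ]

lemma measure_le_add_of_lintegral_sq_le {ν ν' : Measure X} [IsProbabilityMeasure ν]
    [IsProbabilityMeasure ν'] {g : X → ℝ≥0∞} (hg : Measurable g) (hν : ν' = ν.withDensity g)
    {θ : ℝ≥0} (hθ : θ ≠ 0) (hsq : ∫⁻ x, g x ^ 2 ∂ν ≤ 1 + θ ^ 2) {A : Set X}
    (hA : MeasurableSet A) : ν A ≤ ν' A + θ := by
  have hle : 2 * θ * ν A + 2 ≤ 2 * θ * (ν' A + θ) + 2 :=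
    calc 2 * θ * ν A + 2 = ∫⁻ x, A.indicator (fun _ ↦ 2 * (θ : ℝ≥0∞)) x + 2 * g x ∂ν := by
          rw [lintegral_add_left (measurable_const.indicator hA), lintegral_indicator_const hA,
            lintegral_const_mul _ hg, lintegral_eq_one_of_eq_withDensity hν, mul_one]
      _ ≤ ∫⁻ x, A.indicator (fun x ↦ 2 * θ * g x) x + (θ ^ 2 + 1 + g x ^ 2) ∂ν :=
          lintegral_mono (two_mul_indicator_add_le A θ g)
      _ = 2 * θ * ν' A + (θ ^ 2 + 1 + ∫⁻ x, g x ^ 2 ∂ν) := by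
          rw [lintegral_add_left ((hg.const_mul _).indicator hA), lintegral_indicator hA,
            lintegral_const_mul _ hg, ← withDensity_apply _ hA, ← hν,
            lintegral_add_left measurable_const, lintegral_const, measure_univ, mul_one]
      _ ≤ 2 * θ * ν' A + (θ ^ 2 + 1 + (1 + θ ^ 2)) := by gcongr
      _ = 2 * θ * (ν' A + θ) + 2 := by ring
  have hθ₂ : (2 * θ : ℝ≥0∞) ≠ ⊤ := by finiteness
  exact (ENNReal.mul_le_mul_iff_right (by simpa using hθ) hθ₂).1
    ((ENNReal.add_le_add_iff_right ENNReal.ofNat_ne_top).1 hle)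

end LikelihoodRatio

section GaussianRatio

variable {E : Type*} [NormedAddCommGroup E] [InnerProductSpace ℝ E]

/-- The likelihood ratio at `x` of the Gaussians with means `m'` and `m` and identity covariance. -/
noncomputable def gaussianRatio (m m' x : E) : ℝ≥0∞ :=
  ENNReal.ofReal (Real.exp (inner ℝ (m' - m) (x - m) - ‖m' - m‖ ^ 2 / 2))

lemma measurable_gaussianRatio [MeasurableSpace E] [OpensMeasurableSpace E] (m m' : E) :
    Measurable (gaussianRatio m m') := by
  have hcont : Continuous fun x ↦ inner ℝ (m' - m) (x - m) - ‖m' - m‖ ^ 2 / 2 := by fun_prop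
  exact hcont.measurable.exp.ennreal_ofReal

lemma gaussianRatio_sq (m m' x : E) :
    gaussianRatio m m' x ^ 2 =
      ENNReal.ofReal (Real.exp (‖m' - m‖ ^ 2)) * gaussianRatio m (m + (2 : ℝ) • (m' - m)) x := by
  unfold gaussianRatio
  rw [← ENNReal.ofReal_pow (Real.exp_pos _).le, ← ENNReal.ofReal_mul (Real.exp_pos _).le,
    ← Real.exp_nat_mul, ← Real.exp_add, add_sub_cancel_left, real_inner_smul_left, norm_smul,
    mul_pow, Real.norm_ofNat]
  congr 2
  push_cast
  ring

lemma lintegral_gaussianRatio_sq [MeasurableSpace E] [OpensMeasurableSpace E] {γ : E → Measure E}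
    [∀ m, IsProbabilityMeasure (γ m)]
    (hγ : ∀ m m', γ m' = (γ m).withDensity (gaussianRatio m m')) (m m' : E) :
    ∫⁻ x, gaussianRatio m m' x ^ 2 ∂γ m = ENNReal.ofReal (Real.exp (‖m' - m‖ ^ 2)) := by
  simp only [gaussianRatio_sq]
  rw [lintegral_const_mul _ (measurable_gaussianRatio _ _),
    lintegral_eq_one_of_eq_withDensity (hγ m _), mul_one]

lemma gaussianReal_eq_withDensity (m m' : ℝ) :
    gaussianReal m' 1 = (gaussianReal m 1).withDensity (gaussianRatio m m') := by
  rw [gaussianReal_of_var_ne_zero _ one_ne_zero, gaussianReal_of_var_ne_zero _ one_ne_zero,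
    ← withDensity_mul _ (measurable_gaussianPDF _ _) (measurable_gaussianRatio _ _)]
  congr 1
  ext x
  simp only [Pi.mul_apply, gaussianPDF_def, gaussianRatio]
  rw [← ENNReal.ofReal_mul (gaussianPDFReal_nonneg _ _ _), gaussianPDFReal, gaussianPDFReal,
    mul_assoc _ (Real.exp _) (Real.exp _), ← Real.exp_add]
  congr 3
  simp only [NNReal.coe_one, Real.inner_apply, Real.norm_eq_abs, sq_abs]
  ring

variable {d : ℕ}

lemma multivariateGaussian_one_eq_map_pi (m : EuclideanSpace ℝ (Fin d)) :
    multivariateGaussian m 1 =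
      (Measure.pi fun j ↦ gaussianReal (m j) 1).map (WithLp.toLp 2) := by
  have map_translate (j : Fin d) :
      (gaussianReal 0 1).map (fun x ↦ m j + x) = gaussianReal (m j) 1 := by
    simp [gaussianReal_map_const_add]
  have hpi := Measure.pi_map_pi (μ := fun _ : Fin d ↦ gaussianReal 0 1) (f := fun j x ↦ m j + x)
    (hμ := fun j ↦ by rw [map_translate]; infer_instance) (fun j ↦ by fun_prop)
  simp only [map_translate] at hpi
  rw [← hpi, multivariateGaussian_one_eq_map, ← map_pi_eq_stdGaussian,
    Measure.map_map (by fun_prop) (by fun_prop), Measure.map_map (by fun_prop) (by fun_prop)]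
  rfl

lemma gaussianRatio_toLp (m m' : EuclideanSpace ℝ (Fin d)) (x : Fin d → ℝ) :
    gaussianRatio m m' (WithLp.toLp 2 x) = ∏ j, gaussianRatio (m j) (m' j) (x j) := by
  unfold gaussianRatio
  rw [← ENNReal.ofReal_prod_of_nonneg fun j _ ↦ (Real.exp_pos _).le, ← Real.exp_sum,
    EuclideanSpace.real_norm_sq_eq, Finset.sum_sub_distrib, Finset.sum_div]
  simp [PiLp.inner_apply]

lemma multivariateGaussian_eq_withDensity (m m' : EuclideanSpace ℝ (Fin d)) :
    multivariateGaussian m' 1 = (multivariateGaussian m 1).withDensity (gaussianRatio m m') := by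
  ext s hs
  rw [withDensity_apply _ hs, multivariateGaussian_one_eq_map_pi m,
    setLIntegral_map hs (measurable_gaussianRatio m m') (by fun_prop),
    multivariateGaussian_one_eq_map_pi m', Measure.map_apply (by fun_prop) hs,
    pi_withDensity (fun j ↦ measurable_gaussianRatio (m j) (m' j))
      (fun j ↦ gaussianReal_eq_withDensity _ _),
    withDensity_apply _ (hs.preimage (by fun_prop))]
  simp only [gaussianRatio_toLp]

lemma exp_four_mul_sq_le {a : ℝ} (ha : a ^ 2 ≤ 1 / 4) :
    Real.exp (4 * a ^ 2) ≤ 1 + (3 * a) ^ 2 := by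
  have habs : |4 * a ^ 2| ≤ 1 := by
    rw [abs_of_nonneg (by positivity)]
    linarith
  have hexp := le_of_abs_le (Real.abs_exp_sub_one_sub_id_le habs)
  nlinarith [sq_nonneg a]

-- The left-hand side is `1` plus the total variation distance between `N(a, 1)` and `N(-a, 1)`.
lemma lintegral_gaussianRatio_abs_le {a : ℝ} (ha₀ : 0 < a) (ha : a ^ 2 ≤ 1 / 4) :
    ∫⁻ x, gaussianRatio 0 a |x| ∂(gaussianReal 0 1) ≤ ENNReal.ofReal (1 + 3 * a) := by
  have hsq : ∫⁻ x, gaussianRatio a (-a) x ^ 2 ∂(gaussianReal a 1)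
      ≤ 1 + (Real.toNNReal (3 * a) : ℝ≥0∞) ^ 2 := by
    rw [lintegral_gaussianRatio_sq gaussianReal_eq_withDensity]
    change _ ≤ 1 + ENNReal.ofReal (3 * a) ^ 2
    rw [← ENNReal.ofReal_pow (by positivity), ← ENNReal.ofReal_one,
      ← ENNReal.ofReal_add zero_le_one (by positivity)]
    refine ENNReal.ofReal_le_ofReal (le_trans (le_of_eq ?_) (exp_four_mul_sq_le ha))
    rw [Real.norm_eq_abs, sq_abs]
    ring_nf
  have htest := measure_le_add_of_lintegral_sq_le (measurable_gaussianRatio a (-a))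
    (gaussianReal_eq_withDensity a (-a)) (Real.toNNReal_pos.2 (by positivity)).ne' hsq
    (measurableSet_Ici (a := (0 : ℝ)))
  have lintegral_Ici : ∫⁻ x in Set.Ici 0, gaussianRatio 0 a |x| ∂(gaussianReal 0 1)
      = gaussianReal a 1 (Set.Ici 0) := by
    rw [gaussianReal_eq_withDensity 0 a, withDensity_apply _ measurableSet_Ici]
    exact setLIntegral_congr_fun measurableSet_Ici fun x hx ↦ by rw [abs_of_nonneg hx]
  have lintegral_Iio : ∫⁻ x in (Set.Ici 0)ᶜ, gaussianRatio 0 a |x| ∂(gaussianReal 0 1)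
      = gaussianReal (-a) 1 (Set.Ici 0)ᶜ := by
    rw [gaussianReal_eq_withDensity 0 (-a), withDensity_apply _ measurableSet_Ici.compl]
    refine setLIntegral_congr_fun measurableSet_Ici.compl fun x hx ↦ ?_
    rw [abs_of_neg (by simpa using hx)]
    simp [gaussianRatio]
  calc ∫⁻ x, gaussianRatio 0 a |x| ∂(gaussianReal 0 1)
      = gaussianReal a 1 (Set.Ici 0) + gaussianReal (-a) 1 (Set.Ici 0)ᶜ := by
        rw [← lintegral_add_compl _ (measurableSet_Ici (a := (0 : ℝ))), lintegral_Ici,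
          lintegral_Iio]
    _ ≤ gaussianReal (-a) 1 (Set.Ici 0) + ENNReal.ofReal (3 * a)
        + gaussianReal (-a) 1 (Set.Ici 0)ᶜ := add_le_add_left htest _
    _ = ENNReal.ofReal (1 + 3 * a) := by
        rw [add_right_comm, measure_add_measure_compl measurableSet_Ici, measure_univ,
          ENNReal.ofReal_add zero_le_one (by positivity), ENNReal.ofReal_one]

end GaussianRatio

section Cube

open Finset

lemma toNNReal_symm_smul_le_inv_smul {X : Type*} [MeasurableSpace X] {P D : Measure X}
    (hPD : P ≤ D) {τ : ℝ} (hD : D Set.univ ≤ ENNReal.ofReal (Real.exp τ)) {p : I} (hp : τ ≤ p) :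
    unitInterval.toNNReal (unitInterval.symm p) • P ≤ (D Set.univ)⁻¹ • D := by
  have hexp : 1 - (p : ℝ) ≤ Real.exp (-τ) := by
    linarith [Real.add_one_le_exp (-(p : ℝ)), Real.exp_le_exp.2 (neg_le_neg hp)]
  have hc : (unitInterval.toNNReal (unitInterval.symm p) : ℝ≥0∞) ≤ (D Set.univ)⁻¹ := by
    rw [← ENNReal.ofReal_coe_nnreal, unitInterval.coe_toNNReal, unitInterval.coe_symm_eq]
    calc ENNReal.ofReal (1 - p) ≤ ENNReal.ofReal (Real.exp (-τ)) := ENNReal.ofReal_le_ofReal hexp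
      _ = (ENNReal.ofReal (Real.exp τ))⁻¹ := by
          rw [Real.exp_neg, ENNReal.ofReal_inv_of_pos (Real.exp_pos _)]
      _ ≤ (D Set.univ)⁻¹ := ENNReal.inv_le_inv.2 hD
  refine Measure.le_iff.2 fun s _ ↦ ?_
  rw [Measure.smul_apply, Measure.smul_apply, ENNReal.smul_def, smul_eq_mul, smul_eq_mul]
  exact mul_le_mul' hc (hPD s)

variable {d : ℕ}

/-- The vertices of the cube of side `2 * a` centred at `0` and spanned by the coordinates in `J`;
only the values of `sgn` on `J` matter. -/
noncomputable def cubeMean (J : Finset (Fin d)) (a : ℝ) (sgn : Fin d → Bool) :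
    EuclideanSpace ℝ (Fin d) :=
  WithLp.toLp 2 fun j ↦ if j ∈ J then (if sgn j then a else -a) else 0

lemma norm_sq_cubeMean_update_sub_le (J : Finset (Fin d)) (a : ℝ) (sgn : Fin d → Bool)
    (j : Fin d) :
    ‖cubeMean J a (Function.update sgn j (!sgn j)) - cubeMean J a sgn‖ ^ 2 ≤ 4 * a ^ 2 := by
  rw [EuclideanSpace.real_norm_sq_eq, sum_eq_single j]
  · simp only [cubeMean, PiLp.sub_apply, Function.update_self]
    by_cases hj : j ∈ J
    · cases sgn j <;> simp only [hj, if_true, Bool.not_true, Bool.not_false, Bool.false_eq_true,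
        if_false] <;> linarith
    · simp only [hj, if_false, sub_self]
      nlinarith [sq_nonneg a]
  · intro i _ hij
    simp [cubeMean, Function.update_of_ne hij]
  · simp

lemma sq_mul_card_le_norm_sq_sub_cubeMean (J : Finset (Fin d)) {a : ℝ} (ha : 0 ≤ a)
    (sgn : Fin d → Bool) (y : EuclideanSpace ℝ (Fin d)) :
    a ^ 2 * #{j ∈ J | decide (0 ≤ y j) ≠ sgn j} ≤ ‖y - cubeMean J a sgn‖ ^ 2 := by
  rw [EuclideanSpace.real_norm_sq_eq, mul_comm, ← nsmul_eq_mul, ← sum_const]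
  refine (sum_le_sum fun j hj ↦ ?_).trans
    (sum_le_sum_of_subset_of_nonneg (subset_univ _) fun j _ _ ↦ sq_nonneg _)
  obtain ⟨hjJ, hne⟩ := mem_filter.1 hj
  simp only [cubeMean, PiLp.sub_apply, hjJ, if_true]
  cases hsgn : sgn j
  · have hy : 0 ≤ y j := by simpa [hsgn] using hne
    simp only [Bool.false_eq_true, if_false]
    nlinarith
  · have hy : y j < 0 := by simpa [hsgn] using hne
    simp only [if_true]
    nlinarith

/-- The upper envelope of the likelihood ratios, with respect to the standard Gaussian, of the
Gaussians centred at the vertices of the cube. -/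
noncomputable def cubeEnvelope (J : Finset (Fin d)) (a : ℝ) (x : Fin d → ℝ) : ℝ≥0∞ :=
  ∏ j ∈ J, gaussianRatio 0 a |x j|

lemma measurable_cubeEnvelope (J : Finset (Fin d)) (a : ℝ) : Measurable (cubeEnvelope J a) :=
  Finset.measurable_fun_prod J fun j _ ↦
    (measurable_gaussianRatio 0 a).comp (measurable_pi_apply j).abs

lemma gaussianRatio_le_abs {a b : ℝ} (hb : |b| = a) (x : ℝ) :
    gaussianRatio 0 b x ≤ gaussianRatio 0 a |x| := by
  refine ENNReal.ofReal_le_ofReal (Real.exp_le_exp.2 ?_)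
  have hmul : x * b ≤ |x| * a := by
    rw [← hb, ← abs_mul]
    exact le_abs_self _
  simpa [← hb, Real.inner_apply] using hmul

lemma gaussianRatio_cubeMean_le (J : Finset (Fin d)) {a : ℝ} (ha : 0 ≤ a) (sgn : Fin d → Bool)
    (x : Fin d → ℝ) :
    gaussianRatio 0 (cubeMean J a sgn) (WithLp.toLp 2 x) ≤ cubeEnvelope J a x := by
  rw [gaussianRatio_toLp, cubeEnvelope, ← prod_subset (subset_univ J)]
  · refine prod_le_prod' fun j hj ↦ gaussianRatio_le_abs ?_ (x j)
    simp only [cubeMean, hj, if_true]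
    split_ifs
    · exact abs_of_nonneg ha
    · rw [abs_neg, abs_of_nonneg ha]
  · intro j _ hj
    simp [cubeMean, hj, gaussianRatio]

lemma lintegral_cubeEnvelope_le (J : Finset (Fin d)) {a : ℝ} (ha₀ : 0 < a) (ha : a ^ 2 ≤ 1 / 4) :
    ∫⁻ x, cubeEnvelope J a x ∂(Measure.pi fun _ ↦ gaussianReal 0 1)
      ≤ ENNReal.ofReal (Real.exp (3 * a * #J)) := by
  calc ∫⁻ x, cubeEnvelope J a x ∂(Measure.pi fun _ ↦ gaussianReal 0 1)
      = ∏ _j ∈ J, ∫⁻ y, gaussianRatio 0 a |y| ∂(gaussianReal 0 1) :=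
        lintegral_pi_prod _ J fun _ ↦ (measurable_gaussianRatio 0 a).comp measurable_abs
    _ ≤ ∏ _j ∈ J, ENNReal.ofReal (Real.exp (3 * a)) :=
        prod_le_prod' fun _ _ ↦ (lintegral_gaussianRatio_abs_le ha₀ ha).trans
          (ENNReal.ofReal_le_ofReal (by linarith [Real.add_one_le_exp (3 * a)]))
    _ = ENNReal.ofReal (Real.exp (3 * a * #J)) := by
        rw [prod_const, ← ENNReal.ofReal_pow (Real.exp_pos _).le, ← Real.exp_nat_mul, mul_comm]

lemma exists_forall_smul_cubeMean_le (J : Finset (Fin d)) {a : ℝ} (ha₀ : 0 < a)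
    (ha : a ^ 2 ≤ 1 / 4) :
    ∃ Q : Measure (EuclideanSpace ℝ (Fin d)), IsProbabilityMeasure Q ∧
      ∀ (sgn : Fin d → Bool) (p : I), 3 * a * #J ≤ p →
        unitInterval.toNNReal (unitInterval.symm p) •
          multivariateGaussian (cubeMean J a sgn) 1 ≤ Q := by
  let h (x : EuclideanSpace ℝ (Fin d)) : ℝ≥0∞ := cubeEnvelope J a x.ofLp
  have hmeas : Measurable h := (measurable_cubeEnvelope J a).comp (by fun_prop)
  set D := (multivariateGaussian (0 : EuclideanSpace ℝ (Fin d)) 1).withDensity h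
  have hdom (sgn : Fin d → Bool) : multivariateGaussian (cubeMean J a sgn) 1 ≤ D := by
    rw [multivariateGaussian_eq_withDensity 0 (cubeMean J a sgn)]
    exact withDensity_mono (ae_of_all _ fun x ↦ gaussianRatio_cubeMean_le J ha₀.le sgn x.ofLp)
  have huniv : D Set.univ ≤ ENNReal.ofReal (Real.exp (3 * a * #J)) := by
    rw [withDensity_apply _ MeasurableSet.univ, setLIntegral_univ,
      multivariateGaussian_one_eq_map_pi, lintegral_map hmeas (by fun_prop)]
    exact lintegral_cubeEnvelope_le J ha₀ ha
  have hone : 1 ≤ D Set.univ := by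
    simpa using hdom (fun _ ↦ true) Set.univ
  refine ⟨(D Set.univ)⁻¹ • D, ⟨?_⟩, fun sgn p hp ↦
    toNNReal_symm_smul_le_inv_smul (hdom sgn) huniv hp⟩
  rw [Measure.smul_apply, smul_eq_mul, ENNReal.inv_mul_cancel (zero_lt_one.trans_le hone).ne'
    (huniv.trans_lt ENNReal.ofReal_lt_top).ne]

end Cube

section Assouad

open Finset

variable {ι Ω : Type*} [MeasurableSpace Ω]

-- Reverse Markov inequality for the number of the events `p j` that occur.
lemma sum_measureReal_le_card_mul (P : Measure Ω) [IsProbabilityMeasure P] (J : Finset ι)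
    {p : ι → Ω → Prop} [∀ j, DecidablePred (p j)] (hp : ∀ j, MeasurableSet {ω | p j ω})
    {β : ℝ} (hβ : 0 ≤ β) :
    ∑ j ∈ J, P.real {ω | p j ω} ≤ #J * (P.real {ω | β * #J ≤ #{j ∈ J | p j ω}} + β) := by
  set B : Set Ω := {ω | β * #J ≤ #{j ∈ J | p j ω}} with hB
  have card_eq (ω : Ω) :
      (#{j ∈ J | p j ω} : ℝ) = ∑ j ∈ J, {ω | p j ω}.indicator (fun _ ↦ (1 : ℝ)) ω := by
    simp [Set.indicator_apply, sum_boole]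
  have hBm : MeasurableSet B := by
    simp only [hB, card_eq]
    exact measurableSet_le measurable_const
      (Finset.measurable_fun_sum _ fun j _ ↦ measurable_const.indicator (hp j))
  have hint (j : ι) : Integrable ({ω | p j ω}.indicator fun _ ↦ (1 : ℝ)) P :=
    (integrable_const _).indicator (hp j)
  have hintB : Integrable (B.indicator fun _ ↦ (#J : ℝ)) P := (integrable_const _).indicator hBm
  have card_le (ω : Ω) :
      (#{j ∈ J | p j ω} : ℝ) ≤ B.indicator (fun _ ↦ (#J : ℝ)) ω + β * #J := by
    by_cases hω : ω ∈ B
    · rw [Set.indicator_of_mem hω]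
      have hle : (#{j ∈ J | p j ω} : ℝ) ≤ #J := by exact_mod_cast card_filter_le _ _
      exact hle.trans (le_add_of_nonneg_right (by positivity))
    · rw [Set.indicator_of_notMem hω, zero_add]
      exact (not_le.1 hω).le
  calc ∑ j ∈ J, P.real {ω | p j ω}
      = ∫ ω, ∑ j ∈ J, {ω | p j ω}.indicator (fun _ ↦ (1 : ℝ)) ω ∂P := by
        rw [integral_finsetSum _ fun j _ ↦ hint j]
        refine sum_congr rfl fun j _ ↦ ?_
        rw [integral_indicator_const _ (hp j), smul_eq_mul, mul_one]
    _ ≤ ∫ ω, B.indicator (fun _ ↦ (#J : ℝ)) ω + β * #J ∂P :=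
        integral_mono (integrable_finsetSum _ fun j _ ↦ hint j) (hintB.add (integrable_const _))
          fun ω ↦ (card_eq ω).symm.trans_le (card_le ω)
    _ = #J * (P.real B + β) := by
        rw [integral_add hintB (integrable_const _), integral_indicator_const _ hBm,
          integral_const, probReal_univ, smul_eq_mul, smul_eq_mul]
        ring

variable [DecidableEq ι] {ν : (ι → Bool) → Measure Ω} [∀ sgn, IsProbabilityMeasure (ν sgn)] {η : ℝ}

lemma le_measureReal_ne_add {sgn : ι → Bool} {j : ι}
    (hν : ∀ A, MeasurableSet A →
      (ν sgn).real A ≤ (ν (Function.update sgn j (!sgn j))).real A + η)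
    {D : Ω → Bool} (hD : Measurable D) :
    1 - η ≤ (ν sgn).real {ω | D ω ≠ sgn j} +
      (ν (Function.update sgn j (!sgn j))).real
        {ω | D ω ≠ Function.update sgn j (!sgn j) j} := by
  have hmeas : MeasurableSet {ω | D ω ≠ sgn j} := (hD (measurableSet_singleton (sgn j))).compl
  have hcompl : {ω | D ω ≠ Function.update sgn j (!sgn j) j} = {ω | D ω ≠ sgn j}ᶜ := by
    ext ω
    simp only [Function.update_self, Set.mem_compl_iff, Set.mem_ofPred_eq]
    cases D ω <;> cases sgn j <;> simp
  rw [hcompl]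
  linarith [hν _ hmeas.compl, probReal_add_probReal_compl (μ := ν sgn) hmeas]

-- Flipping the `j`-th sign pairs the laws `ν sgn`, and no test `D` tells the two laws of a pair
-- apart.
lemma sum_half_le_sum_measureReal_ne [Fintype ι] {j : ι}
    (hν : ∀ sgn A, MeasurableSet A →
      (ν sgn).real A ≤ (ν (Function.update sgn j (!sgn j))).real A + η)
    {D : Ω → Bool} (hD : Measurable D) :
    ∑ _sgn : ι → Bool, (1 - η) / 2 ≤ ∑ sgn, (ν sgn).real {ω | D ω ≠ sgn j} := by
  let err (sgn : ι → Bool) : ℝ := (ν sgn).real {ω | D ω ≠ sgn j}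
  have hinv : Function.Involutive fun sgn : ι → Bool ↦ Function.update sgn j (!sgn j) := by
    intro sgn
    simp
  have hpair : ∑ _sgn : ι → Bool, (1 - η) ≤
      ∑ sgn, (err sgn + err (Function.update sgn j (!sgn j))) :=
    sum_le_sum fun sgn _ ↦ le_measureReal_ne_add (hν sgn) hD
  have hflip : ∑ sgn, err (Function.update sgn j (!sgn j)) = ∑ sgn, err sgn :=
    Equiv.sum_comp hinv.toPerm err
  rw [sum_add_distrib, hflip] at hpair
  rw [← sum_div]
  linarith

/-- Assouad's lemma, in probability instead of in expectation. -/
lemma exists_le_measureReal_card_ne [Finite ι] (J : Finset ι) (hJ : J.Nonempty)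
    (hν : ∀ j sgn A, MeasurableSet A →
      (ν sgn).real A ≤ (ν (Function.update sgn j (!sgn j))).real A + η)
    {D : ι → Ω → Bool} (hD : ∀ j, Measurable (D j)) {β : ℝ} (hβ : 0 ≤ β) :
    ∃ sgn, (1 - η) / 2 - β ≤ (ν sgn).real {ω | β * #J ≤ #{j ∈ J | D j ω ≠ sgn j}} := by
  have := Fintype.ofFinite ι
  have hsum : ∑ _sgn : ι → Bool, ∑ _j ∈ J, (1 - η) / 2
      ≤ ∑ sgn, ∑ j ∈ J, (ν sgn).real {ω | D j ω ≠ sgn j} := by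
    rw [sum_comm, sum_comm (s := univ) (t := J)]
    exact sum_le_sum fun j _ ↦ sum_half_le_sum_measureReal_ne (hν j) (hD j)
  obtain ⟨sgn, -, hsgn⟩ := exists_le_of_sum_le univ_nonempty hsum
  refine ⟨sgn, ?_⟩
  have hcount := hsgn.trans <| sum_measureReal_le_card_mul (ν sgn) J
    (p := fun j ω ↦ D j ω ≠ sgn j) (fun j ↦ (hD j (measurableSet_singleton (sgn j))).compl) hβ
  rw [sum_const, nsmul_eq_mul] at hcount
  have hcard : (0 : ℝ) < #J := by exact_mod_cast hJ.card_pos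
  linarith [le_of_mul_le_mul_left hcount hcard]

end Assouad

section SampleLaw

variable {n : ℕ} {E : Type*} [MeasurableSpace E]

/-- The law of the `i`-th sample in the lower bound: the clean law `P` if the contamination rate is
at most `t`, and otherwise the law `Q`, from which nothing can be learnt about `P`. -/
noncomputable def sampleLaw (lam : Fin n → I) (t : I) (P Q : Measure E) (i : Fin n) : Measure E :=
  if lam i ≤ t then P else Q

variable {lam : Fin n → I} {t : I} {P P' Q : Measure E} [IsProbabilityMeasure P]
  [IsProbabilityMeasure P'] [IsProbabilityMeasure Q]

instance (i : Fin n) : IsProbabilityMeasure (sampleLaw lam t P Q i) := by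
  unfold sampleLaw
  split_ifs <;> infer_instance

lemma pi_sampleLaw_mem_contaminatedLaws
    (hQ : ∀ p : I, t ≤ p → unitInterval.toNNReal (unitInterval.symm p) • P ≤ Q) :
    Measure.pi (sampleLaw lam t P Q) ∈ contaminatedLaws lam P := by
  have hmix (i : Fin n) : ∃ Q' : Measure E, IsProbabilityMeasure Q' ∧
      unitInterval.toNNReal (lam i) • Q' + unitInterval.toNNReal (unitInterval.symm (lam i)) • P
        = sampleLaw lam t P Q i := by
    unfold sampleLaw
    split_ifs with h
    · refine ⟨P, inferInstance, ?_⟩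
      rw [← add_smul, unitInterval.toNNReal_add_toNNReal_symm, one_smul]
    · rw [not_le] at h
      exact exists_mixture_eq (unitInterval.nonneg'.trans_lt h).ne' (hQ _ h.le)
  choose Q' _ hmix using hmix
  exact pi_mem_contaminatedLaws hmix

lemma measureReal_pi_sampleLaw_le_add {g : E → ℝ≥0∞} (hg : Measurable g)
    (hP : P' = P.withDensity g) {θ : ℝ≥0} (hθ : θ ≠ 0)
    (hsq : (∫⁻ x, g x ^ 2 ∂P) ^ numBelow lam t ≤ 1 + θ ^ 2) {A : Set (Fin n → E)}
    (hA : MeasurableSet A) :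
    (Measure.pi (sampleLaw lam t P Q)).real A ≤ (Measure.pi (sampleLaw lam t P' Q)).real A + θ := by
  let f (i : Fin n) : E → ℝ≥0∞ := if lam i ≤ t then g else 1
  have hf (i : Fin n) : Measurable (f i) := by
    simp only [f]
    split_ifs
    exacts [hg, measurable_one]
  have hdens (i : Fin n) : sampleLaw lam t P' Q i = (sampleLaw lam t P Q i).withDensity (f i) := by
    simp only [sampleLaw, f]
    split_ifs
    exacts [hP, withDensity_one.symm]
  have lintegral_sq (i : Fin n) :
      ∫⁻ x, f i x ^ 2 ∂(sampleLaw lam t P Q i) = if lam i ≤ t then ∫⁻ x, g x ^ 2 ∂P else 1 := by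
    simp only [sampleLaw, f]
    split_ifs <;> simp
  have lintegral_prod_sq : ∫⁻ z, (∏ i, f i (z i)) ^ 2 ∂(Measure.pi (sampleLaw lam t P Q))
      = (∫⁻ x, g x ^ 2 ∂P) ^ numBelow lam t := by
    simp only [← Finset.prod_pow]
    rw [lintegral_pi_prod _ Finset.univ fun i ↦ (hf i).pow_const 2]
    simp only [lintegral_sq]
    rw [Finset.prod_ite, Finset.prod_const_one, mul_one, Finset.prod_const, ← numBelow]
  have hle := measure_le_add_of_lintegral_sq_le
    (Finset.measurable_fun_prod _ fun i _ ↦ (hf i).comp (measurable_pi_apply i))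
    (pi_withDensity hf hdens) hθ (lintegral_prod_sq.trans_le hsq) hA
  rw [measureReal_def, measureReal_def, ← ENNReal.coe_toReal θ,
    ← ENNReal.toReal_add (measure_ne_top _ _) ENNReal.coe_ne_top]
  exact ENNReal.toReal_mono (by finiteness) hle

end SampleLaw

section LowerBound

open Finset

variable {n d : ℕ} {lam : Fin n → I} {t : I} {J : Finset (Fin d)} {a : ℝ}

lemma lintegral_gaussianRatio_sq_pow_le {m m' : EuclideanSpace ℝ (Fin d)} {N : ℕ}
    (hm : N * ‖m' - m‖ ^ 2 ≤ 1 / 125) :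
    (∫⁻ x, gaussianRatio m m' x ^ 2 ∂(multivariateGaussian m 1)) ^ N
      ≤ 1 + ((1 / 10 : ℝ≥0) : ℝ≥0∞) ^ 2 := by
  have hexp : Real.exp (1 / 125) ≤ 1 + (1 / 10) ^ 2 := by
    have habs := Real.abs_exp_sub_one_sub_id_le (x := 1 / 125) (by rw [abs_of_pos] <;> norm_num)
    linarith [le_of_abs_le habs]
  rw [lintegral_gaussianRatio_sq multivariateGaussian_eq_withDensity,
    ← ENNReal.ofReal_pow (Real.exp_pos _).le, ← Real.exp_nat_mul]
  refine (ENNReal.ofReal_le_ofReal ((Real.exp_le_exp.2 hm).trans hexp)).trans_eq ?_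
  rw [ENNReal.ofReal_add zero_le_one (by positivity), ENNReal.ofReal_one,
    ENNReal.ofReal_pow (by positivity), ← ENNReal.ofReal_coe_nnreal]
  norm_num

lemma measurable_decide_nonneg {X : Type*} [MeasurableSpace X] {f : X → ℝ} (hf : Measurable f) :
    Measurable fun x ↦ decide (0 ≤ f x) := by
  refine measurable_to_bool ?_
  have hpre : (fun x ↦ decide (0 ≤ f x)) ⁻¹' {true} = {x | 0 ≤ f x} := by
    ext
    simp
  rw [hpre]
  exact measurableSet_le measurable_const hf

lemma exists_contaminatedLaws_error_ge (hJ : J.Nonempty) (ha₀ : 0 < a) (ha : a ^ 2 ≤ 1 / 4)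
    (ht : 3 * a * #J ≤ t) (hN : numBelow lam t * (4 * a ^ 2) ≤ 1 / 125)
    {M : (Fin n → EuclideanSpace ℝ (Fin d)) → EuclideanSpace ℝ (Fin d)} (hM : Measurable M) :
    ∃ P ∈ idGaussians d, ∃ ν ∈ contaminatedLaws lam P,
      ENNReal.ofReal (7 / 20) ≤
        ν {z | ENNReal.ofReal (a ^ 2 * #J / 10) ≤ ‖M z - ∫ x, x ∂P‖ₑ ^ 2} := by
  obtain ⟨Q, _, hdom⟩ := exists_forall_smul_cubeMean_le J ha₀ ha
  let γ (sgn : Fin d → Bool) : Measure (EuclideanSpace ℝ (Fin d)) :=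
    multivariateGaussian (cubeMean J a sgn) 1
  have indistinguishable (j : Fin d) (sgn : Fin d → Bool)
      (A : Set (Fin n → EuclideanSpace ℝ (Fin d))) (hA : MeasurableSet A) :
      (Measure.pi (sampleLaw lam t (γ sgn) Q)).real A
        ≤ (Measure.pi (sampleLaw lam t (γ (Function.update sgn j (!sgn j))) Q)).real A
          + (1 / 10 : ℝ≥0) := by
    refine measureReal_pi_sampleLaw_le_add (measurable_gaussianRatio _ _)
      (multivariateGaussian_eq_withDensity _ _) (by norm_num)
      (lintegral_gaussianRatio_sq_pow_le (le_trans ?_ hN)) hA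
    gcongr
    exact norm_sq_cubeMean_update_sub_le J a sgn j
  obtain ⟨sgn, hsgn⟩ := exists_le_measureReal_card_ne J hJ indistinguishable
    (D := fun j z ↦ decide (0 ≤ M z j)) (fun j ↦ measurable_decide_nonneg (by fun_prop))
    (β := 1 / 10) (by norm_num)
  refine ⟨_, ⟨cubeMean J a sgn, rfl⟩, _,
    pi_sampleLaw_mem_contaminatedLaws fun p hp ↦ hdom sgn p (ht.trans hp), ?_⟩
  have hlevel : (7 / 20 : ℝ) ≤ (1 - (1 / 10 : ℝ≥0)) / 2 - 1 / 10 := by norm_num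
  refine ((ENNReal.ofReal_le_iff_le_toReal (measure_ne_top _ _)).2 (hlevel.trans hsgn)).trans
    (measure_mono fun z hz ↦ ?_)
  rw [Set.mem_ofPred_eq] at hz ⊢
  rw [integral_id_multivariateGaussian, ← ofReal_norm, ← ENNReal.ofReal_pow (norm_nonneg _)]
  refine ENNReal.ofReal_le_ofReal
    (le_trans ?_ (sq_mul_card_le_norm_sq_sub_cubeMean J ha₀.le sgn (M z)))
  linarith [mul_le_mul_of_nonneg_left hz (sq_nonneg a)]

lemma ofReal_le_minimaxPAC (hJ : J.Nonempty) (ha₀ : 0 < a) (ha : a ^ 2 ≤ 1 / 4)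
    (ht : 3 * a * #J ≤ t) (hN : numBelow lam t * (4 * a ^ 2) ≤ 1 / 125) :
    ENNReal.ofReal (a ^ 2 * #J / 10) ≤ minimaxPAC lam (idGaussians d) (1 / 5) := by
  have hlt : (1 / 5 : ℝ≥0∞) < ENNReal.ofReal (7 / 20) := by
    rw [ENNReal.lt_ofReal_iff_toReal_lt (by finiteness)]
    norm_num
  exact le_minimaxPAC hlt fun M hM ↦ exists_contaminatedLaws_error_ge hJ ha₀ ha ht hN hM

lemma numBelow_mul_le_of_effectiveRate_eq {F : ℝ} (hF : effectiveRate d lam = ENNReal.ofReal F)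
    (ht : (t : ℝ) ^ 2 ≤ F / 2) :
    numBelow lam t * F ≤ 2 * d := by
  obtain hN | hN := Nat.eq_zero_or_pos (numBelow lam t)
  · simp [hN]
  have hobj : effectiveRate d lam ≤ thresholdObjective d lam t := iInf_le _ t
  rw [hF, thresholdObjective_eq_ofReal d hN, ENNReal.ofReal_le_ofReal_iff (by positivity)] at hobj
  have hhalf : F / 2 ≤ d / numBelow lam t := by linarith
  rw [le_div_iff₀ (by exact_mod_cast hN)] at hhalf
  linarith

lemma sqrt_le_two_mul_natSqrt (hd : 1 ≤ d) : √(d : ℝ) ≤ 2 * Nat.sqrt d := by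
  have hone : 1 ≤ Nat.sqrt d := Nat.le_sqrt'.2 (by simpa using hd)
  have hlt : d < (2 * Nat.sqrt d) ^ 2 :=
    (Nat.lt_succ_sqrt' d).trans_le (Nat.pow_le_pow_left (by lia) 2)
  rw [Real.sqrt_le_left (by positivity)]
  exact_mod_cast hlt.le

-- A cube of dimension about `√d` suffices: its vertices are at distance `a * √(√d)` from its
-- centre, but need only contamination `3 * a * √d`, which is of order `√F`.
lemma ofReal_div_sqrt_le_minimaxPAC (hd : 1 ≤ d) {F : ℝ} (hF₀ : 0 < F) (hF₁ : F ≤ 1)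
    (hF : effectiveRate d lam = ENNReal.ofReal F) :
    ENNReal.ofReal (F / √d / 20000) ≤ minimaxPAC lam (idGaussians d) (1 / 5) := by
  obtain ⟨J, -, hJ⟩ := exists_subset_card_eq (s := (univ : Finset (Fin d))) (n := Nat.sqrt d)
    (by rw [card_univ, Fintype.card_fin]; exact Nat.sqrt_le_self d)
  have hJ₀ : J.Nonempty := by
    rw [← card_pos, hJ]
    exact Nat.sqrt_pos.2 hd
  have hJ_sq : (#J : ℝ) ^ 2 ≤ d := by
    rw [hJ]
    exact_mod_cast Nat.sqrt_le' d
  have hJ_sqrt : √(d : ℝ) ≤ 2 * #J := hJ ▸ sqrt_le_two_mul_natSqrt hd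
  have hd₁ : (1 : ℝ) ≤ d := by exact_mod_cast hd
  set a : ℝ := √(F / (1000 * d))
  have ha₀ : 0 < a := Real.sqrt_pos.2 (by positivity)
  have ha_sq : a ^ 2 * d = F / 1000 := by
    rw [Real.sq_sqrt (by positivity)]
    field_simp
  have ha : a ^ 2 ≤ 1 / 4 := by nlinarith
  have ht_sq : (3 * a * #J) ^ 2 ≤ F / 2 := by
    nlinarith [mul_le_mul_of_nonneg_left hJ_sq (sq_nonneg a)]
  let t : I := ⟨3 * a * #J, by positivity, by nlinarith⟩
  have hN := numBelow_mul_le_of_effectiveRate_eq (t := t) hF ht_sq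
  refine le_trans (ENNReal.ofReal_le_ofReal ?_)
    (ofReal_le_minimaxPAC (t := t) hJ₀ ha₀ ha le_rfl ?_)
  · have hs₀ : 0 < √(d : ℝ) := by positivity
    have hdJ : F ≤ a ^ 2 * (2000 * (#J * √(d : ℝ))) := by
      nlinarith [mul_le_mul_of_nonneg_left hJ_sqrt (mul_nonneg (sq_nonneg a) hs₀.le),
        Real.sq_sqrt (zero_le_one.trans hd₁)]
    rw [div_div, div_le_iff₀ (by positivity)]
    linarith
  · refine le_of_mul_le_mul_right ?_ (zero_lt_one.trans_le hd₁)
    calc numBelow lam t * (4 * a ^ 2) * d = numBelow lam t * F / 250 := by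
          rw [mul_assoc, mul_assoc, ha_sq]
          ring
      _ ≤ 1 / 125 * d := by linarith

lemma effectiveRate_div_sqrt_le_minimaxPAC (hd : 1 ≤ d) {F : ℝ} (hF₀ : 0 < F) (hF₁ : F ≤ 1)
    (hF : effectiveRate d lam = ENNReal.ofReal F) :
    ((1 / 20000 : ℝ≥0) : ℝ≥0∞) * (effectiveRate d lam / ENNReal.ofReal √d)
      ≤ minimaxPAC lam (idGaussians d) (1 / 5) := by
  rw [hF, ← ENNReal.ofReal_div_of_pos (by positivity), ← ENNReal.ofReal_coe_nnreal,
    ← ENNReal.ofReal_mul NNReal.zero_le_coe]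
  refine le_trans (ENNReal.ofReal_le_ofReal (le_of_eq ?_))
    (ofReal_div_sqrt_le_minimaxPAC hd hF₀ hF₁ hF)
  push_cast
  ring

end LowerBound

theorem theorem2 :
    ∃ c c₁ C : ℝ≥0, 0 < c ∧ 0 < c₁ ∧ 0 < C ∧
      ∀ (d n : ℕ) (_ : 1 ≤ d) (lam : Fin n → I), effectiveRate d lam ≤ (c : ℝ≥0∞) →
        (c₁ : ℝ≥0∞) * (effectiveRate d lam / ENNReal.ofReal (Real.sqrt d))
            ≤ minimaxPAC lam (idGaussians d) (1 / 5) ∧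
        minimaxPAC lam (idGaussians d) (1 / 5) ≤ (C : ℝ≥0∞) * effectiveRate d lam ∧
        -- the threshold estimator is well defined: the minimum over `t` and the maximal depth
        -- are attained
        (∃ t : I, ∀ s : I, thresholdObjective d lam t ≤ thresholdObjective d lam s) ∧
        (∀ (t : I) (z : Fin n → EuclideanSpace ℝ (Fin d)),
          ∃ η, IsTukeyMedian (thresholdWeights lam t) z η) ∧
        -- and, for every minimizer `t` and every choice of the Tukey medians, it attains the
        -- upper bound
        ∀ t : I, (∀ s : I, thresholdObjective d lam t ≤ thresholdObjective d lam s) →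
          ∀ M : (Fin n → EuclideanSpace ℝ (Fin d)) → EuclideanSpace ℝ (Fin d),
            (∀ z, IsTukeyMedian (thresholdWeights lam t) z (M z)) →
            (⨆ P ∈ idGaussians d, ⨆ ν ∈ contaminatedLaws lam P,
              ν {z | (C : ℝ≥0∞) * effectiveRate d lam ≤ ‖M z - ∫ x, x ∂P‖ₑ ^ 2}) ≤ 1 / 5 := by
  refine ⟨1 / 10 ^ 10, 1 / 20000, 10 ^ 10, by positivity, by positivity, by positivity,
    fun d n hd lam hf ↦ ?_⟩
  have hC : ((10 ^ 10 : ℝ≥0) : ℝ≥0∞) = ENNReal.ofReal (10 ^ 10) := by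
    rw [← ENNReal.ofReal_coe_nnreal]
    norm_num
  obtain ⟨t, ht⟩ := exists_forall_thresholdObjective_le d lam
  obtain ⟨hN, hF₁, hF⟩ := effectiveRate_eq_ofReal_of_forall_le hd hf ht
  push_cast at hF₁
  refine ⟨?_, ?_, ⟨t, ht⟩, fun s z ↦ exists_isTukeyMedian hd _ z, fun s hs M hM ↦ ?_⟩
  · exact effectiveRate_div_sqrt_le_minimaxPAC hd (by positivity) (hF₁.trans (by norm_num)) hF
  · rw [hC, hF]
    exact minimaxPAC_idGaussians_le hd hN hF₁
  · obtain ⟨hN', hF₁', hF'⟩ := effectiveRate_eq_ofReal_of_forall_le hd hf hs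
    rw [hC, hF']
    push_cast at hF₁'
    exact iSup_contaminatedLaws_isTukeyMedian_le hd hN' hF₁' hM
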